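/- **Setting.** Let $D\subset\mathbb R^d$ be a bounded domain (nonempty, open, connected, bounded) with Lipschitz boundary, i.e. near each boundary point and in suitable orthonormal coordinates $D$ is the set of points lying strictly above the graph of a Lipschitz function. For an integer $s\ge 0$ let $C^s(\bar D;\mathbb R^r)$ be the Banach space of functions on $\bar D$ that are $s$ times continuously differentiable in $D$ and whose derivatives of order at most $s$ extend continuously to $\bar D$, with norm $\|f\|_{C^s}=\sum_{j=0}^s\sup_{x\in D}\|D^jf(x)\|$. Let $\sigma\in C^\infty(\mathbb R)$ be non-polynomial and Lipschitz continuous; $\sigma$ acts componentwise on vectors. For $v:D\to\mathbb R^{d_v}$, $u:D\to\mathbb R^{d_u}$ and matrices $Q\in\mathbb R^{d_K\times d_v}$, $K\in\mathbb R^{d_K\times d_u}$, $V\in\mathbb R^{d_V\times d_u}$, cross-attention is $$\mathsf C(v,u;Q,K,V)(x)=\int_D \pi(y;v,u,x)\,Vu(y)\,dy,\qquad \pi(y;v,u,x)=\frac{\exp\langle Qv(x),Ku(y)\rangle}{\int_D\exp\langle Qv(x),Ku(z)\rangle\,dz}.$$ **Architecture.** A *cross-attention based transformer neural operator* with $L\ge1$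 encoder layers, query functions $v:D\to\mathbb R^\ell$, inputs $u:D\to\mathbb R^r$ and outputs $D\to\mathbb R^{r'}$ is a map $$\Psi(v,u;\theta)=\bigl(\mathsf T_{\rm out}\circ\mathsf D(v,\cdot)\circ\mathsf E_L\circ\mathsf T_{\rm in}\bigr)(u)$$ with some channel dimension $c$, where: * $\mathsf T_{\rm in}(u)(x)=R_2\,\sigma\bigl(R_1(u(x),x)+b_R\bigr)+b_R'\in\mathbb R^c$ and $\mathsf T_{\rm out}(w)(x)=P_2\,\sigma\bigl(P_1(w(x),x)+b_P\bigr)+b_P'\in\mathbb R^{r'}$; * $\mathsf E_L$ is the composition of $L$ layers on functions $D\to\mathbb R^c$, each (with its own parameters) consisting of the two successive updates $u\mapsfrom W_1^{\mathsf E}u+\mathsf C(u,u;Q^{\mathsf E},K^{\mathsf E},V^{\mathsf E})$ and $u\mapsfrom W_2^{\mathsf E}u+W_3^{\mathsf E}\sigma(W_4^{\mathsf E}u+b_1^{\mathsf E})+b_2^{\mathsf E}$; * $\mathsf D(v,u)$ is the result of the successive updates $v\mapsfrom S_{\rm in}v\in\mathbb R^c$, then $v\mapsfrom W_1^{\mathsf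 D}v+\mathsf C(v,v;Q_1^{\mathsf D},K_1^{\mathsf D},V_1^{\mathsf D})$, then $v\mapsfrom W_2^{\mathsf D}(v,u)+\mathsf C(v,u;Q_2^{\mathsf D},K_2^{\mathsf D},V_2^{\mathsf D})$, and finally $v\mapsfrom W_3^{\mathsf D}v+W_4^{\mathsf D}\sigma(W_5^{\mathsf D}v+b_1^{\mathsf D})+b_2^{\mathsf D}$. All matrices and vectors are part of the parameter $\theta$, as are $c$, the hidden widths and the dimensions $d_K$; there is no layer normalization. **Theorem.** Let $D$ and $\sigma$ be as above, let $s,s'\ge0$ and $L\ge1$ be integers, and fix a bounded measurable query function $v:D\to\mathbb R^\ell$. Let $\Psi^\dagger:C^s(\bar D;\mathbb R^r)\to C^{s'}(\bar D;\mathbb R^{r'})$ be continuous and let $K\subset C^s(\bar D;\mathbb R^r)$ be compact. Then for every $\epsilon>0$ there is a cross-attention based transformer neural operator with $L$ encoder layers, i.e. a parameter $\theta$, such that $\Psi(v,u;\theta)\in C^{s'}(\bar D;\mathbb R^{r'})$ (that is, $\Psi(v,u;\theta)$ extends from $D$ to such a function) for every $u\in K$, and $$\sup_{u\in K}\bigl\|\Psi^\dagger(u)-\Psi(v,u;\theta)\bigr\|_{C^{s'}}\le\epsilon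 .$$ -/

import Mathlib

open Set MeasureTheory Polynomial
open scoped BoundedContinuousFunction RealInnerProductSpace ContDiff

noncomputable section

/-- Euclidean space `ℝⁿ`. -/
abbrev Euc (n : ℕ) : Type := EuclideanSpace ℝ (Fin n)

/-! ### Lipschitz domains -/

/-- `D` has Lipschitz boundary: near each boundary point, after choosing a "vertical" unit vector
`e`, the set `D` is the part lying strictly above the graph of a Lipschitz function `γ` of the
component of `x` orthogonal to `e` (only the values of `γ` on the hyperplane `e^⊥` matter). -/
def HasLipschitzBoundary {d : ℕ} (D : Set (Euc d)) : Prop :=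
  ∀ p ∈ frontier D, ∃ e : Euc d, ‖e‖ = 1 ∧ ∃ ρ : ℝ, 0 < ρ ∧
    ∃ (M : NNReal) (γ : Euc d → ℝ), LipschitzWith M γ ∧
      ∀ x ∈ Metric.ball p ρ, x ∈ D ↔ γ (x - ⟪e, x⟫ • e) < ⟪e, x⟫

/-- A bounded domain (nonempty, connected, open, bounded set) with Lipschitz boundary. -/
structure IsBoundedLipschitzDomain {d : ℕ} (D : TopologicalSpace.Opens (Euc d)) : Prop where
  connected : IsConnected (D : Set (Euc d))
  bounded : Bornology.IsBounded (D : Set (Euc d))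
  lipschitz : HasLipschitzBoundary (D : Set (Euc d))

/-! ### The Banach space `C^s(D̄; F)` -/

section CkBar

variable {d : ℕ} (D : TopologicalSpace.Opens (Euc d)) (s : ℕ)
  (F : Type*) [NormedAddCommGroup F]

/-- The closure of `D`, as a type. -/
abbrev ClosureOf : Type := ↥(closure (D : Set (Euc d)))

variable {D} in
/-- The inclusion of `D` in its closure. -/
def toClosure (x : D) : ClosureOf D := ⟨x.1, subset_closure x.2⟩

variable {D F} in
/-- Extension by zero of a function on the closure of `D`, used to take derivatives at points
of the open set `D`. -/
def extZero (f : ClosureOf D → F) : Euc d → F := Function.extend Subtype.val f 0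

variable {D F} in
lemma extZero_apply (f : ClosureOf D → F) (x : D) : extZero f x = f (toClosure x) :=
  Subtype.val_injective.extend_apply f 0 (toClosure x)

variable {D F} in
lemma extZero_add (f g : ClosureOf D → F) : extZero (f + g) = extZero f + extZero g := by
  funext x
  by_cases h : ∃ a : ClosureOf D, a.1 = x
  · obtain ⟨a, rfl⟩ := h
    simp [extZero]
  · simp [extZero, Function.extend_apply' _ _ _ h]

variable [NormedSpace ℝ F]

variable {D F} in
lemma extZero_smul (c : ℝ) (f : ClosureOf D → F) : extZero (c • f) = c • extZero f := by
  funext x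
  by_cases h : ∃ a : ClosureOf D, a.1 = x
  · obtain ⟨a, rfl⟩ := h
    simp [extZero]
  · simp [extZero, Function.extend_apply' _ _ _ h]

variable {D} in
lemma toClosure_dense : DenseRange (toClosure (D := D)) := by
  intro x
  rw [closure_subtype]
  have h : Subtype.val '' range (toClosure (D := D)) = (D : Set (Euc d)) := by
    ext y
    constructor
    · rintro ⟨_, ⟨a, rfl⟩, rfl⟩
      exact a.2
    · intro hy
      exact ⟨_, ⟨⟨y, hy⟩, rfl⟩, rfl⟩
  rw [h]
  exact x.2

variable {D F} in
/-- `g` is the continuous extension to the closure of `D` of the `j`-th derivative of `f`. -/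
def IsDerivExt (j : ℕ) (f : ClosureOf D → F)
    (g : ClosureOf D →ᵇ ContinuousMultilinearMap ℝ (fun _ : Fin j => Euc d) F) : Prop :=
  ∀ x : D, g (toClosure x) = iteratedFDeriv ℝ j (extZero f) x

/-- The continuous functions on the closure of `D` that are `s` times continuously differentiable
in `D` and all of whose derivatives of order at most `s` extend continuously (and boundedly, which
is automatic for bounded `D`) to the closure of `D`. -/
def ckSubmodule : Submodule ℝ (ClosureOf D →ᵇ F) where
  carrier := {f | ContDiffOn ℝ s (extZero f) D ∧ ∀ j ≤ s, ∃ g, IsDerivExt j f g}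
  zero_mem' := by
    have h0 : extZero (⇑(0 : ClosureOf D →ᵇ F)) = 0 := by
      funext x
      simp only [BoundedContinuousFunction.coe_zero]
      have := congrFun (extZero_smul (D := D) (F := F) 0 0) x
      simpa using this
    refine ⟨by rw [h0]; exact contDiffOn_const, fun j _ => ⟨0, fun x => ?_⟩⟩
    rw [h0]
    simp
  add_mem' := by
    rintro f₁ f₂ ⟨h₁, H₁⟩ ⟨h₂, H₂⟩
    refine ⟨?_, fun j hj => ?_⟩
    · rw [BoundedContinuousFunction.coe_add, extZero_add]
      exact h₁.add h₂
    · obtain ⟨g₁, hg₁⟩ := H₁ j hj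
      obtain ⟨g₂, hg₂⟩ := H₂ j hj
      refine ⟨g₁ + g₂, fun x => ?_⟩
      have hx : (D : Set (Euc d)) ∈ nhds (x : Euc d) := D.isOpen.mem_nhds x.2
      have c₁ := ((h₁.contDiffAt hx).of_le (by exact_mod_cast hj : (j : WithTop ℕ∞) ≤ s))
      have c₂ := ((h₂.contDiffAt hx).of_le (by exact_mod_cast hj : (j : WithTop ℕ∞) ≤ s))
      rw [BoundedContinuousFunction.coe_add, BoundedContinuousFunction.coe_add, extZero_add,
        iteratedFDeriv_add_apply c₁ c₂, Pi.add_apply, hg₁ x, hg₂ x]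
  smul_mem' := by
    rintro c f ⟨h, H⟩
    refine ⟨?_, fun j hj => ?_⟩
    · rw [BoundedContinuousFunction.coe_smul]
      change ContDiffOn ℝ s (extZero (c • ⇑f)) D
      rw [extZero_smul]
      exact h.const_smul c
    · obtain ⟨g, hg⟩ := H j hj
      refine ⟨c • g, fun x => ?_⟩
      have hx : (D : Set (Euc d)) ∈ nhds (x : Euc d) := D.isOpen.mem_nhds x.2
      have c₁ := ((h.contDiffAt hx).of_le (by exact_mod_cast hj : (j : WithTop ℕ∞) ≤ s))
      change c • g (toClosure x) = iteratedFDeriv ℝ j (extZero (c • ⇑f)) x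
      rw [extZero_smul, iteratedFDeriv_const_smul_apply c₁, hg x]

/-- The space `C^s(D̄; F)`. It is a type of its own, so that it carries the `C^s` norm
and not the supremum norm. -/
def CkBar : Type _ := ↥(ckSubmodule D s F)

namespace CkBar

instance : AddCommGroup (CkBar D s F) := inferInstanceAs (AddCommGroup ↥(ckSubmodule D s F))

instance : Module ℝ (CkBar D s F) := inferInstanceAs (Module ℝ ↥(ckSubmodule D s F))

variable {D s F}

/-- The underlying function on the closure of `D`. -/
def toBCF (f : CkBar D s F) : ClosureOf D →ᵇ F := f.1

instance : CoeFun (CkBar D s F) (fun _ => ClosureOf D → F) := ⟨fun f => ⇑f.toBCF⟩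

/-- The `j`-th derivative of `f`, continuously extended to the closure of `D`. -/
def derivExt (f : CkBar D s F) (j : Fin (s + 1)) :
    ClosureOf D →ᵇ ContinuousMultilinearMap ℝ (fun _ : Fin (j : ℕ) => Euc d) F :=
  Classical.choose (f.2.2 j (Nat.lt_succ_iff.mp j.2))

lemma derivExt_spec (f : CkBar D s F) (j : Fin (s + 1)) : IsDerivExt (j : ℕ) f (f.derivExt j) :=
  Classical.choose_spec (f.2.2 j (Nat.lt_succ_iff.mp j.2))

lemma derivExt_unique (f : CkBar D s F) (j : Fin (s + 1))
    {g : ClosureOf D →ᵇ ContinuousMultilinearMap ℝ (fun _ : Fin (j : ℕ) => Euc d) F}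
    (hg : IsDerivExt (j : ℕ) f g) : f.derivExt j = g := by
  apply DFunLike.coe_injective
  refine toClosure_dense.equalizer (f.derivExt j).continuous g.continuous ?_
  funext x
  exact (f.derivExt_spec j x).trans (hg x).symm

variable (D s F) in
/-- The target of the jet map, with the sum of the supremum norms as its norm. -/
def JetSpace : Type _ := PiLp 1 (fun j : Fin (s + 1) =>
    ClosureOf D →ᵇ ContinuousMultilinearMap ℝ (fun _ : Fin (j : ℕ) => Euc d) F)

set_option synthInstance.maxHeartbeats 400000 in
instance : NormedAddCommGroup (JetSpace D s F) := inferInstanceAs (NormedAddCommGroup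
  (PiLp 1 (fun j : Fin (s + 1) =>
    ClosureOf D →ᵇ ContinuousMultilinearMap ℝ (fun _ : Fin (j : ℕ) => Euc d) F)))

set_option synthInstance.maxHeartbeats 400000 in
instance : NormedSpace ℝ (JetSpace D s F) := inferInstanceAs (NormedSpace ℝ
  (PiLp 1 (fun j : Fin (s + 1) =>
    ClosureOf D →ᵇ ContinuousMultilinearMap ℝ (fun _ : Fin (j : ℕ) => Euc d) F)))

variable (D s F) in
/-- The map sending `f` to `(f, D f, …, D^s f)`; the target carries the sum of the supremum
norms. -/
def jet : CkBar D s F →ₗ[ℝ] JetSpace D s F where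
  toFun f := WithLp.toLp 1 fun j => f.derivExt j
  map_add' f₁ f₂ := by
    refine PiLp.ext fun j => ?_
    change (f₁ + f₂).derivExt j = f₁.derivExt j + f₂.derivExt j
    refine derivExt_unique _ _ fun x => ?_
    have hj : ((j : ℕ) : WithTop ℕ∞) ≤ s := by exact_mod_cast Nat.lt_succ_iff.mp j.2
    have hx : (D : Set (Euc d)) ∈ nhds (x : Euc d) := D.isOpen.mem_nhds x.2
    have c₁ := (f₁.2.1.contDiffAt hx).of_le hj
    have c₂ := (f₂.2.1.contDiffAt hx).of_le hj
    change f₁.derivExt j (toClosure x) + f₂.derivExt j (toClosure x)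
      = iteratedFDeriv ℝ j (extZero (⇑f₁.1 + ⇑f₂.1)) x
    rw [extZero_add, iteratedFDeriv_add_apply c₁ c₂, f₁.derivExt_spec j x, f₂.derivExt_spec j x]
    rfl
  map_smul' c f := by
    refine PiLp.ext fun j => ?_
    change (c • f).derivExt j = c • f.derivExt j
    refine derivExt_unique _ _ fun x => ?_
    have hj : ((j : ℕ) : WithTop ℕ∞) ≤ s := by exact_mod_cast Nat.lt_succ_iff.mp j.2
    have hx : (D : Set (Euc d)) ∈ nhds (x : Euc d) := D.isOpen.mem_nhds x.2
    have c₁ := (f.2.1.contDiffAt hx).of_le hj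
    change c • f.derivExt j (toClosure x) = iteratedFDeriv ℝ j (extZero (c • ⇑f.1)) x
    rw [extZero_smul, iteratedFDeriv_const_smul_apply c₁, f.derivExt_spec j x]
    rfl

lemma jet_injective : Function.Injective (jet D s F) := by
  intro f₁ f₂ h
  have h0 : f₁.derivExt 0 = f₂.derivExt 0 :=
    congrArg (fun z : PiLp 1 (fun j : Fin (s + 1) => ClosureOf D →ᵇ
      ContinuousMultilinearMap ℝ (fun _ : Fin (j : ℕ) => Euc d) F) => z 0) h
  apply Subtype.ext
  apply DFunLike.coe_injective
  refine toClosure_dense.equalizer f₁.1.continuous f₂.1.continuous ?_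
  funext x
  have h₁ := f₁.derivExt_spec 0 x
  have h₂ := f₂.derivExt_spec 0 x
  rw [h0, h₂] at h₁
  have h₃ : extZero f₂ x = extZero f₁ x := congrArg (fun m => m (fun _ => 0)) h₁
  rw [extZero_apply, extZero_apply] at h₃
  exact h₃.symm

/-- The `C^s` norm, the sum over `j = 0, …, s` of the supremum norm of the `j`-th derivative. -/
instance : NormedAddCommGroup (CkBar D s F) := NormedAddCommGroup.induced _ _ (jet D s F)
  jet_injective

instance : NormedSpace ℝ (CkBar D s F) :=
  NormedSpace.induced ℝ (CkBar D s F) (JetSpace D s F) (jet D s F)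

lemma norm_def (f : CkBar D s F) : ‖f‖ = ∑ j : Fin (s + 1), ‖f.derivExt j‖ := by
  change ‖jet D s F f‖ = _
  exact PiLp.norm_eq_of_L1 (β := fun j : Fin (s + 1) =>
    ClosureOf D →ᵇ ContinuousMultilinearMap ℝ (fun _ : Fin (j : ℕ) => Euc d) F) _

end CkBar

end CkBar

/-! ### Cross-attention -/

/-- Parameters of cross-attention: query, key and value matrices. -/
structure AttentionParams (dv du dV : ℕ) where
  dK : ℕ
  Q : Euc dv →L[ℝ] Euc dK
  K : Euc du →L[ℝ] Euc dK
  V : Euc du →L[ℝ] Euc dV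

namespace AttentionParams

variable {X Y : Type*} [MeasureSpace X] {dv du dV : ℕ}

/-- The probability density `π(y; v, u, x)`. -/
def density (θ : AttentionParams dv du dV) (v : Y → Euc dv) (u : X → Euc du) (x : Y) (y : X) : ℝ :=
  Real.exp ⟪θ.Q (v x), θ.K (u y)⟫ / ∫ s, Real.exp ⟪θ.Q (v x), θ.K (u s)⟫

/-- Cross-attention `C(v, u)(x) = 𝔼_{y ∼ π(·; v, u, x)} [V u(y)]`. -/
def crossAttention (θ : AttentionParams dv du dV) (v : Y → Euc dv) (u : X → Euc du) (x : Y) :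
    Euc dV :=
  ∫ y, θ.density v u x y • θ.V (u y)

end AttentionParams

/-! ### The transformer neural operator -/

/-- Lebesgue measure on the open set `D`. -/
instance {d : ℕ} (D : TopologicalSpace.Opens (Euc d)) : MeasureSpace D :=
  Measure.Subtype.measureSpace

/-- Componentwise application of the activation function. -/
def applyAct (σ : ℝ → ℝ) {n : ℕ} (z : Euc n) : Euc n := WithLp.toLp 2 fun i => σ (z i)

/-- Parameters of a pointwise two-layer network acting on `(u(x), x)`, with `u(x) ∈ ℝᵐ`,
`x ∈ ℝᵈ`, and values in `ℝⁿ`. -/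
structure PointwiseNet (m d n : ℕ) where
  width : ℕ
  A₁ : (Euc m × Euc d) →L[ℝ] Euc width
  b : Euc width
  A₂ : Euc width →L[ℝ] Euc n
  b' : Euc n

/-- `x ↦ A₂ σ(A₁ (u(x), x) + b) + b'`. -/
def PointwiseNet.eval (σ : ℝ → ℝ) {m d n : ℕ} (θ : PointwiseNet m d n)
    {D : TopologicalSpace.Opens (Euc d)} (u : D → Euc m) (x : D) : Euc n :=
  θ.A₂ (applyAct σ (θ.A₁ (u x, (x : Euc d)) + θ.b)) + θ.b'

/-- Parameters of one encoder layer with channel dimension `c`. -/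
structure EncoderLayer (c : ℕ) where
  att : AttentionParams c c c
  W₁ : Euc c →L[ℝ] Euc c
  W₂ : Euc c →L[ℝ] Euc c
  width : ℕ
  W₃ : Euc width →L[ℝ] Euc c
  W₄ : Euc c →L[ℝ] Euc width
  b₁ : Euc width
  b₂ : Euc c

/-- One encoder layer: self-attention followed by a feedforward network, with residual terms and
without layer normalization. -/
def EncoderLayer.eval (σ : ℝ → ℝ) {c d : ℕ} (θ : EncoderLayer c)
    {D : TopologicalSpace.Opens (Euc d)} (u : D → Euc c) : D → Euc c :=
  let u₁ : D → Euc c := fun x => θ.W₁ (u x) + θ.att.crossAttention u u x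
  fun x => θ.W₂ (u₁ x) + θ.W₃ (applyAct σ (θ.W₄ (u₁ x) + θ.b₁)) + θ.b₂

/-- Parameters of the decoder, with query functions valued in `ℝˡ` and channel dimension `c`. -/
structure Decoder (l c : ℕ) where
  Sin : Euc l →L[ℝ] Euc c
  att₁ : AttentionParams c c c
  att₂ : AttentionParams c c c
  W₁ : Euc c →L[ℝ] Euc c
  W₂ : (Euc c × Euc c) →L[ℝ] Euc c
  W₃ : Euc c →L[ℝ] Euc c
  width : ℕ
  W₄ : Euc width →L[ℝ] Euc c
  W₅ : Euc c →L[ℝ] Euc width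
  b₁ : Euc width
  b₂ : Euc c

/-- The decoder: lifting and self-attention of the query function `v`, cross-attention with the
encoded input `u` (with a residual of `u`), and a feedforward network, without layer
normalization. -/
def Decoder.eval (σ : ℝ → ℝ) {l c d : ℕ} (θ : Decoder l c)
    {D : TopologicalSpace.Opens (Euc d)} (v : D → Euc l) (u : D → Euc c) : D → Euc c :=
  let v₁ : D → Euc c := fun x => θ.Sin (v x)
  let v₂ : D → Euc c := fun x => θ.W₁ (v₁ x) + θ.att₁.crossAttention v₁ v₁ x
  let v₃ : D → Euc c := fun x => θ.W₂ (v₂ x, u x) + θ.att₂.crossAttention v₂ u x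
  fun x => θ.W₃ (v₃ x) + θ.W₄ (applyAct σ (θ.W₅ (v₃ x) + θ.b₁)) + θ.b₂

/-- Parameters `θ` of a cross-attention based transformer neural operator with `L` encoder layers,
for query functions valued in `ℝˡ`, inputs valued in `ℝʳ` and outputs valued in `ℝ^{r'}`. -/
structure CrossTransformer (L d l r r' : ℕ) where
  c : ℕ
  Tin : PointwiseNet r d c
  enc : Fin L → EncoderLayer c
  dec : Decoder l c
  Tout : PointwiseNet c d r'

/-- `Ψ(v, u; θ) = (T_out ∘ D(v, ·) ∘ E_L ∘ T_in)(u)`, as a function on `D`. -/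
def CrossTransformer.eval (σ : ℝ → ℝ) {L d l r r' : ℕ} (θ : CrossTransformer L d l r r')
    {D : TopologicalSpace.Opens (Euc d)} (v : D → Euc l) (u : D → Euc r) : D → Euc r' :=
  let w₀ : D → Euc θ.c := θ.Tin.eval σ u
  let w : D → Euc θ.c := (List.ofFn θ.enc).foldl (fun w layer => layer.eval σ w) w₀
  θ.Tout.eval σ (θ.dec.eval σ v w)

end

/-! With zero query and key matrices the attention weights are uniform, so attention takes averages
over `D`. Let the encoder layers act as the identity and let the decoder return the average of its
input. What remains is the class of maps sending `u` to the function `x ↦ ∑ₖ σ(∑ᵢ Cₖᵢ Aᵢ(u) + ⟪qₖ,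
x⟫ + bₖ) aₖ`, where each `Aᵢ(u)` is the average over `y` of `σ(wᵢ(u(y), y) + βᵢ)`
(`exists_crossTransformer_eval_eq`). This class is already universal.

The link is the exponential, which turns sums into products. If `l` is a linear combination of
averages, then `exp(l(u) + ⟪q, x⟫) a` is the tensor of the scalar function `exp(l(u))` on `K` and
the element `exp⟪q, x⟫ a` of the target space. Tensors of total sets are total in `C(K, V)`
(`exists_sum_tensor_near`), so three facts suffice.

(a) The functions `exp ∘ l` are total in `C(K)`. By Stone–Weierstrass this asks that the averages
separate `K` (`averageRidge_separates`). They do: averages of `σ`-ridges determine those of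
exponentials, hence those of every continuous function of `(u(y), y)`, and `‖u'(y) - u(y)‖` is such
a function of `(u'(y), y)` (`eq_of_integral_ridge_eq`).

(b) The functions `exp⟪q, x⟫ a` are total in `C^s'(D̄)`
(`IsBoundedLipschitzDomain.exists_sum_exp_near`). Local translations into `D`, glued by a partition
of unity, replace `f` by a compactly supported `C^s'` function on the whole space; this is where the
Lipschitz boundary enters. That function is mollified, and the mollifier is approximated uniformly
by exponentials. Convolution puts all derivatives on the function, so uniform approximation of the
kernel is enough.

(c) On bounded intervals `exp` is a `C^m` limit of combinations of `σ(lam t + b)`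
(`exists_sum_ridge_near_exp`). Derivatives in `lam` at `0` give all monomials, since no derivative
of a smooth non-polynomial function vanishes identically; the exponential series does the rest. -/

/-! ### Density of exponentials -/

/-- The exponential of a continuous function. -/
noncomputable def ContinuousMap.rexp {X : Type*} [TopologicalSpace X] (f : C(X, ℝ)) : C(X, ℝ) :=
  ⟨fun x => Real.exp (f x), Real.continuous_exp.comp f.continuous⟩

/-- Stone–Weierstrass for exponentials of a point-separating vector space of functions. -/
lemma exists_sum_exp_near {X : Type*} [TopologicalSpace X] [CompactSpace X]
    (S : Submodule ℝ C(X, ℝ)) (hS : ∀ x y : X, x ≠ y → ∃ l ∈ S, l x ≠ l y)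
    (f : C(X, ℝ)) {ε : ℝ} (hε : 0 < ε) :
    ∃ (n : ℕ) (a : Fin n → ℝ) (l : Fin n → C(X, ℝ)), (∀ i, l i ∈ S) ∧
      ∀ x, |f x - ∑ i, a i * Real.exp (l i x)| ≤ ε := by
  let T : Submonoid C(X, ℝ) :=
    { carrier := {g | ∃ l ∈ S, l.rexp = g}
      one_mem' := ⟨0, S.zero_mem, by ext; simp [ContinuousMap.rexp]⟩
      mul_mem' := by
        rintro _ _ ⟨l, hl, rfl⟩ ⟨l', hl', rfl⟩
        exact ⟨l + l', S.add_mem hl hl', by ext; simp [ContinuousMap.rexp, Real.exp_add]⟩ }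
  have hsep : (Algebra.adjoin ℝ (T : Set C(X, ℝ))).SeparatesPoints := by
    intro x y hxy
    obtain ⟨l, hl, hne⟩ := hS x y hxy
    refine ⟨l.rexp, ⟨l.rexp, Algebra.subset_adjoin ⟨l, hl, rfl⟩, rfl⟩, fun h => hne ?_⟩
    exact Real.exp_injective h
  obtain ⟨⟨g, hg⟩, hgf⟩ :=
    ContinuousMap.exists_mem_subalgebra_near_continuousMap_of_separatesPoints _ hsep f ε hε
  -- Exponentials of elements of `S` are closed under multiplication, so the algebra they generate
  -- is just their linear span.
  rw [← Subalgebra.mem_toSubmodule, Algebra.adjoin_eq_span, Submonoid.closure_eq,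
    Submodule.mem_span_set'] at hg
  obtain ⟨n, a, t, rfl⟩ := hg
  choose l hl hlt using fun i => (t i).2
  refine ⟨n, a, l, hl, fun x => ?_⟩
  have := ((ContinuousMap.norm_lt_iff _ hε).1 hgf x).le
  rw [ContinuousMap.sub_apply, Real.norm_eq_abs, abs_sub_comm] at this
  simpa [← hlt, ContinuousMap.rexp] using this

/-! ### Approximation of the exponential by a non-polynomial activation function -/

lemma exists_polynomial_deriv_eq (p : ℝ[X]) : ∃ q : ℝ[X], derivative q = p := by
  induction p using Polynomial.induction_on' with
  | add p₁ p₂ h₁ h₂ =>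
    obtain ⟨q₁, rfl⟩ := h₁
    obtain ⟨q₂, rfl⟩ := h₂
    exact ⟨q₁ + q₂, by simp⟩
  | monomial n a =>
    refine ⟨monomial (n + 1) (a / (n + 1)), ?_⟩
    rw [derivative_monomial]
    have : (n + 1 : ℝ) ≠ 0 := by positivity
    simp [this]

/-- Integrate `k` times. This provides, for each order, a point at which that derivative of a
non-polynomial `σ` does not vanish. -/
lemma exists_polynomial_of_iteratedDeriv_eq_zero (k : ℕ) :
    ∀ {f : ℝ → ℝ}, ContDiff ℝ ∞ f → (∀ x, iteratedDeriv k f x = 0) →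
      ∃ p : ℝ[X], ∀ x, f x = p.eval x := by
  induction k with
  | zero => exact fun _ h => ⟨0, by simpa using h⟩
  | succ k ih =>
    intro f hf h
    have hf' : ContDiff ℝ ∞ (deriv f) := (contDiff_infty_iff_deriv.1 hf).2
    obtain ⟨p, hp⟩ := ih hf' (by simpa [iteratedDeriv_succ'] using h)
    obtain ⟨q, rfl⟩ := exists_polynomial_deriv_eq p
    have hdf : Differentiable ℝ f := (contDiff_infty_iff_deriv.1 hf).1
    refine ⟨q + C (f 0 - q.eval 0), fun x => ?_⟩
    have hconst := is_const_of_deriv_eq_zero (f := fun x => f x - q.eval x)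
      (hdf.sub q.differentiable) (fun y => by
        rw [deriv_fun_sub hdf.differentiableAt q.differentiableAt, hp, Polynomial.deriv, sub_self])
      x 0
    simp only [eval_add, eval_C]
    linarith

/-- A curve of continuous functions on a compact space, differentiable pointwise with continuous
derivative, is differentiable. -/
lemma hasDerivAt_continuousMap {X : Type*} [TopologicalSpace X] [CompactSpace X]
    {H H' : ℝ → C(X, ℝ)} (hH' : Continuous H')
    (h : ∀ x l, HasDerivAt (fun l => H l x) (H' l x) l) (l : ℝ) : HasDerivAt H (H' l) l := by
  -- Evaluation at a point commutes with the integral, so the scalar fundamental theorem of calculus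
  -- upgrades to an identity in the Banach space `C(X, ℝ)`, which can then be differentiated in
  -- norm.
  have key : H = fun m => H 0 + ∫ t in (0 : ℝ)..m, H' t := by
    funext m
    ext x
    have e : (∫ t in (0 : ℝ)..m, H' t) x = ∫ t in (0 : ℝ)..m, H' t x :=
      ((ContinuousMap.evalCLM ℝ x).intervalIntegral_comp_comm
        (hH'.intervalIntegrable 0 m)).symm
    rw [ContinuousMap.add_apply, e,
      intervalIntegral.integral_eq_sub_of_hasDerivAt (fun t _ => h x t)
        (((ContinuousMap.evalCLM ℝ x).continuous.comp hH').intervalIntegrable 0 m)]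
    ring
  rw [key]
  exact (intervalIntegral.integral_hasDerivAt_right (hH'.intervalIntegrable 0 l)
    (hH'.stronglyMeasurableAtFilter _ _) hH'.continuousAt).const_add _

/-- A partial derivative is the full derivative applied to `(1, 0)`. Joint smoothness is what makes
the parameter derivatives of ridge functions continuous for the supremum norm. -/
lemma contDiff_iteratedDeriv_fst {F : ℝ × ℝ → ℝ} (hF : ContDiff ℝ ∞ F) (k : ℕ) :
    ContDiff ℝ ∞ fun p : ℝ × ℝ => iteratedDeriv k (fun l => F (l, p.2)) p.1 := by
  induction k with
  | zero => simpa using hF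
  | succ k ih =>
    set G : ℝ × ℝ → ℝ := fun p => iteratedDeriv k (fun l => F (l, p.2)) p.1 with hG
    have e : (fun p : ℝ × ℝ => iteratedDeriv (k + 1) (fun l => F (l, p.2)) p.1) =
        fun p => fderiv ℝ G p (1, 0) := by
      funext p
      rw [iteratedDeriv_succ]
      have h1 : HasFDerivAt G (fderiv ℝ G p) p :=
        (ih.differentiable (by simp)).differentiableAt.hasFDerivAt
      have h2 : HasDerivAt (fun l : ℝ => ((l, p.2) : ℝ × ℝ)) (1, 0) p.1 :=
        (hasDerivAt_id p.1).prodMk (hasDerivAt_const p.1 p.2)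
      exact (h1.comp_hasDerivAt p.1 h2).deriv
    rw [e]
    exact (ih.fderiv_right (m := ∞) (by simp)).clm_apply contDiff_const

/-- In the Leibniz formula only the term with exactly `j` derivatives on `l ^ j` survives at `0`.
For `j > k` there is none, and `descFactorial` vanishes too. -/
lemma iteratedDeriv_pow_mul_zero (j k : ℕ) {g : ℝ → ℝ} (hg : ContDiff ℝ ∞ g) :
    iteratedDeriv k (fun l => l ^ j * g l) 0 =
      k.descFactorial j * iteratedDeriv (k - j) g 0 := by
  rw [iteratedDeriv_fun_mul (by fun_prop) (hg.contDiffAt.of_le (by exact_mod_cast le_top))]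
  simp only [iteratedDeriv_fun_pow_zero]
  by_cases hjk : j ≤ k
  · rw [Finset.sum_eq_single j (fun i _ hij => by simp [hij])
      (fun h => absurd (Finset.mem_range.2 (by omega)) h)]
    rw [if_pos rfl, Nat.descFactorial_eq_factorial_mul_choose]
    push_cast
    ring
  · rw [Nat.descFactorial_of_lt (by omega)]
    refine (Finset.sum_eq_zero fun i hi => ?_).trans (by simp)
    rw [if_neg (by have := Finset.mem_range.1 hi; omega)]
    simp

lemma iteratedDeriv_comp_mul_add {n : ℕ} {f : ℝ → ℝ} (hf : ContDiff ℝ ∞ f) (a b x : ℝ) :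
    iteratedDeriv n (fun t => f (a * t + b)) x = a ^ n * iteratedDeriv n f (a * x + b) := by
  have h1 : ContDiff ℝ n (fun t => f (t + b)) :=
    (hf.comp (contDiff_id.add contDiff_const)).of_le (by exact_mod_cast le_top)
  have := congrFun (iteratedDeriv_comp_const_mul h1 a) x
  simp only [iteratedDeriv_comp_add_const] at this
  simpa using this

/-! ### Jets of ridge functions and their derivatives in the parameter -/

section Ridge

variable {σ : ℝ → ℝ} (hσ : ContDiff ℝ ∞ σ) (R : ℝ) (m : ℕ)

lemma contDiff_iteratedDeriv_infty {σ : ℝ → ℝ} (hσ : ContDiff ℝ ∞ σ) (k : ℕ) :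
    ContDiff ℝ ∞ (iteratedDeriv k σ) := by
  rw [iteratedDeriv_eq_iterate]
  exact hσ.iterate_deriv k

/-- The jet of order `m` of the ridge function `t ↦ σ (lam * t + b)` on `[-R, R]`. -/
noncomputable def ridgeJet (b lam : ℝ) : Fin (m + 1) → C(Icc (-R) R, ℝ) := fun j =>
  ⟨fun t => lam ^ (j : ℕ) * iteratedDeriv j σ (lam * t + b), by
    have := (contDiff_iteratedDeriv_infty hσ j).continuous
    fun_prop⟩

/-- The closed span of the jets of all ridge functions. -/
noncomputable def ridgeSpan : Submodule ℝ (Fin (m + 1) → C(Icc (-R) R, ℝ)) :=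
  (Submodule.span ℝ (range fun q : ℝ × ℝ => ridgeJet hσ R m q.1 q.2)).topologicalClosure

/-- The jet of order `m` of the monomial `t ↦ t ^ k` on `[-R, R]`. -/
noncomputable def powJet (k : ℕ) : Fin (m + 1) → C(Icc (-R) R, ℝ) := fun j =>
  ⟨fun t => k.descFactorial j * (t : ℝ) ^ (k - (j : ℕ)), by fun_prop⟩

/-- The `k`-th derivative in `lam` of `ridgeJet`. -/
noncomputable def ridgeJetDeriv (b : ℝ) (k : ℕ) (lam : ℝ) : Fin (m + 1) → C(Icc (-R) R, ℝ) := fun j =>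
  ⟨fun t => iteratedDeriv k (fun l => l ^ (j : ℕ) * iteratedDeriv j σ (l * t + b)) lam, by
    have h : ContDiff ℝ ∞ fun p : ℝ × ℝ =>
        p.1 ^ (j : ℕ) * iteratedDeriv j σ (p.1 * p.2 + b) :=
      (contDiff_fst.pow _).mul ((contDiff_iteratedDeriv_infty hσ j).comp
        ((contDiff_fst.mul contDiff_snd).add contDiff_const))
    exact (contDiff_iteratedDeriv_fst h k).continuous.comp (by fun_prop :
      Continuous fun t : Icc (-R) R => (lam, (t : ℝ)))⟩

lemma hasDerivAt_ridgeJetDeriv (b : ℝ) (k : ℕ) (lam : ℝ) :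
    HasDerivAt (ridgeJetDeriv hσ R m b k) (ridgeJetDeriv hσ R m b (k + 1) lam) lam := by
  rw [hasDerivAt_pi]
  intro j
  have h : ContDiff ℝ ∞ fun p : ℝ × ℝ => p.1 ^ (j : ℕ) * iteratedDeriv j σ (p.1 * p.2 + b) :=
    (contDiff_fst.pow _).mul ((contDiff_iteratedDeriv_infty hσ j).comp
      ((contDiff_fst.mul contDiff_snd).add contDiff_const))
  refine hasDerivAt_continuousMap (H := fun l => ridgeJetDeriv hσ R m b k l j)
    (H' := fun l => ridgeJetDeriv hσ R m b (k + 1) l j) ?_ (fun t l => ?_) lam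
  · refine ContinuousMap.continuous_of_continuous_uncurry _ ?_
    exact (contDiff_iteratedDeriv_fst h (k + 1)).continuous.comp
      (by fun_prop : Continuous fun q : ℝ × Icc (-R) R => (q.1, (q.2 : ℝ)))
  · have h1 : ContDiff ℝ ∞ fun l : ℝ => l ^ (j : ℕ) * iteratedDeriv j σ (l * t + b) :=
      h.comp (contDiff_id.prodMk contDiff_const)
    have := ((h1.differentiable_iteratedDeriv k (by exact_mod_cast ENat.natCast_lt_top k)) l).hasDerivAt
    rw [← iteratedDeriv_succ] at this
    exact this

/-- A derivative is a limit of difference quotients, so a closed subspace that contains a curve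
contains its derivatives. -/
lemma ridgeJetDeriv_mem (b : ℝ) (k : ℕ) (lam : ℝ) :
    ridgeJetDeriv hσ R m b k lam ∈ ridgeSpan hσ R m := by
  induction k generalizing lam with
  | zero =>
    refine Submodule.le_topologicalClosure _ (Submodule.subset_span ⟨(b, lam), ?_⟩)
    funext j
    ext t
    simp [ridgeJetDeriv, ridgeJet]
  | succ k ih =>
    rw [← (hasDerivAt_ridgeJetDeriv hσ R m b k lam).deriv]
    have h := range_deriv_subset_closure_span_image (ridgeJetDeriv hσ R m b k) dense_univ
      (mem_range_self lam)
    have hle : Submodule.span ℝ (ridgeJetDeriv hσ R m b k '' univ) ≤ ridgeSpan hσ R m :=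
      Submodule.span_le.2 (by rintro _ ⟨l, -, rfl⟩; exact ih l)
    exact closure_minimal hle (Submodule.isClosed_topologicalClosure _) h

/-- The `k`-th derivative of `σ (lam * t + b)` in `lam` at `lam = 0` is `t ^ k` times the `k`-th
derivative of `σ` at `b`; choose `b` where the latter is nonzero and divide. Working with jets gives
the same for all `t`-derivatives up to order `m` at once. -/
lemma powJet_mem (hσp : ¬ ∃ p : ℝ[X], ∀ x : ℝ, σ x = p.eval x) (k : ℕ) :
    powJet R m k ∈ ridgeSpan hσ R m := by
  obtain ⟨b, hb⟩ : ∃ b, iteratedDeriv k σ b ≠ 0 := by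
    by_contra! h
    exact hσp (exists_polynomial_of_iteratedDeriv_eq_zero k hσ h)
  have h : powJet R m k = (iteratedDeriv k σ b)⁻¹ • ridgeJetDeriv hσ R m b k 0 := by
    funext j
    ext t
    simp only [powJet, ridgeJetDeriv, Pi.smul_apply, ContinuousMap.smul_apply,
      ContinuousMap.coe_mk, smul_eq_mul]
    have h1 : ContDiff ℝ ∞ fun l : ℝ => iteratedDeriv j σ (l * t + b) :=
      (contDiff_iteratedDeriv_infty hσ j).comp ((contDiff_id.mul contDiff_const).add contDiff_const)
    rw [iteratedDeriv_pow_mul_zero _ _ h1]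
    by_cases hjk : (j : ℕ) ≤ k
    · have h2 := iteratedDeriv_comp_mul_add (n := k - j) (contDiff_iteratedDeriv_infty hσ j)
        (t : ℝ) b 0
      simp only [mul_comm (t : ℝ)] at h2
      rw [h2, iteratedDeriv_eq_iterate, iteratedDeriv_eq_iterate, iteratedDeriv_eq_iterate,
        ← Function.iterate_add_apply, Nat.sub_add_cancel hjk, ← iteratedDeriv_eq_iterate]
      simp only [zero_mul, zero_add]
      field_simp
    · simp [Nat.descFactorial_of_lt (not_le.1 hjk)]
  rw [h]
  exact Submodule.smul_mem _ _ (ridgeJetDeriv_mem hσ R m b k 0)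

/-- The jet of order `m` of the exponential on `[-R, R]`. -/
noncomputable def expJet : Fin (m + 1) → C(Icc (-R) R, ℝ) := fun _ => ⟨fun t => Real.exp t, by fun_prop⟩

/-- In each component this is the exponential series in the Banach algebra of continuous functions:
the `j`-th derivative kills the first `j` terms and shifts the rest, reproducing the series. -/
lemma hasSum_expJet : HasSum (fun k : ℕ => ((k.factorial : ℝ)⁻¹) • powJet R m k) (expJet R m) := by
  rw [Pi.hasSum]
  intro j
  have h0 : HasSum (fun k : ℕ => ((k.factorial : ℝ)⁻¹) •
      (⟨fun t => (t : ℝ), by fun_prop⟩ : C(Icc (-R) R, ℝ)) ^ k) (expJet R m j) := by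
    have hexp : expJet R m j =
        NormedSpace.exp (⟨fun t => (t : ℝ), by fun_prop⟩ : C(Icc (-R) R, ℝ)) := by
      refine ContinuousMap.ext fun t => ?_
      have h2 := NormedSpace.map_exp (ContinuousMap.evalStarAlgHom ℝ ℝ t)
        (continuous_eval_const t) (⟨fun t => (t : ℝ), by fun_prop⟩ : C(Icc (-R) R, ℝ))
      refine Eq.trans ?_ h2.symm
      simp only [expJet, ContinuousMap.coe_mk, Real.exp_eq_exp_ℝ]
      rfl
    rw [hexp]
    exact NormedSpace.exp_series_hasSum_exp' (𝕂 := ℝ)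
      (⟨fun t => (t : ℝ), by fun_prop⟩ : C(Icc (-R) R, ℝ))
  rw [← hasSum_nat_add_iff' (j : ℕ)]
  have hz : ∑ i ∈ Finset.range (j : ℕ), ((i.factorial : ℝ)⁻¹ • powJet R m i) j = 0 := by
    refine Finset.sum_eq_zero fun i hi => ?_
    ext t
    simp [powJet, Nat.descFactorial_of_lt (Finset.mem_range.1 hi)]
  rw [hz, sub_zero]
  refine h0.congr_fun fun k => ContinuousMap.ext fun t => ?_
  simp only [Pi.smul_apply, ContinuousMap.smul_apply, powJet, ContinuousMap.coe_mk, smul_eq_mul,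
    ContinuousMap.pow_apply, Nat.add_sub_cancel]
  have := Nat.factorial_mul_descFactorial (Nat.le_add_left (j : ℕ) k)
  rw [Nat.add_sub_cancel] at this
  rw [← this]
  have h1 : (k.factorial : ℝ) ≠ 0 := by positivity
  have h2 : ((k + j).descFactorial j : ℝ) ≠ 0 := by
    have := (Nat.descFactorial_pos (n := k + j) (k := j)).2 (by omega)
    positivity
  push_cast
  field_simp

end Ridge

/-- The exponential is approximated, together with its derivatives of order at most `m`, by linear
combinations of ridge functions of a smooth non-polynomial activation function. -/
lemma exists_sum_ridge_near_exp {σ : ℝ → ℝ} (hσ : ContDiff ℝ ∞ σ)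
    (hσp : ¬ ∃ p : ℝ[X], ∀ x : ℝ, σ x = p.eval x) (R : ℝ) (m : ℕ) {ε : ℝ} (hε : 0 < ε) :
    ∃ (n : ℕ) (a lam b : Fin n → ℝ), ∀ j ≤ m, ∀ t : ℝ, |t| ≤ R →
      |iteratedDeriv j (fun t => Real.exp t - ∑ i, a i * σ (lam i * t + b i)) t| ≤ ε := by
  have hmem : expJet R m ∈ ridgeSpan hσ R m :=
    (Submodule.isClosed_topologicalClosure _).mem_of_tendsto (hasSum_expJet R m)
      (Filter.Eventually.of_forall fun s => Submodule.sum_mem _ fun k _ =>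
        Submodule.smul_mem _ _ (powJet_mem hσ R m hσp k))
  obtain ⟨g, hg, hdist⟩ := Metric.mem_closure_iff.1 hmem ε hε
  replace hg : g ∈ Submodule.span ℝ _ := hg
  rw [Submodule.mem_span_set'] at hg
  obtain ⟨n, a, q, rfl⟩ := hg
  choose q' hq' using fun i => (q i).2
  refine ⟨n, a, fun i => (q' i).2, fun i => (q' i).1, fun j hj t ht => ?_⟩
  have hc : ∀ i, ContDiff ℝ ∞ fun t => σ ((q' i).2 * t + (q' i).1) := fun i =>
    hσ.comp ((contDiff_const.mul contDiff_id).add contDiff_const)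
  have hle : ∀ {f : ℝ → ℝ}, ContDiff ℝ ∞ f → ContDiffAt ℝ j f t := fun h =>
    h.contDiffAt.of_le (by exact_mod_cast le_top)
  rw [iteratedDeriv_fun_sub (hle Real.contDiff_exp)
    (hle (ContDiff.sum fun i _ => contDiff_const.mul (hc i))),
    iteratedDeriv_fun_sum (fun i _ => hle (contDiff_const.mul (hc i))), iteratedDeriv_eq_iterate,
    Real.iter_deriv_exp]
  have h1 : dist (expJet R m ⟨j, by omega⟩ ⟨t, abs_le.1 ht⟩)
      ((∑ i, a i • (q i : Fin (m + 1) → C(Icc (-R) R, ℝ))) ⟨j, by omega⟩ ⟨t, abs_le.1 ht⟩) ≤ ε :=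
    (ContinuousMap.dist_apply_le_dist _).trans ((dist_le_pi_dist _ _ _).trans hdist.le)
  rw [Real.dist_eq] at h1
  convert h1 using 3
  · rfl
  rw [Finset.sum_apply, ContinuousMap.sum_apply]
  refine Finset.sum_congr rfl fun i _ => ?_
  rw [← hq' i, iteratedDeriv_const_mul_field, iteratedDeriv_comp_mul_add hσ]
  rfl

/-! ### Norms and derivatives in `C^s(D̄; F)` -/

section CkBarLemmas

variable {d : ℕ} {D : TopologicalSpace.Opens (Euc d)} {s : ℕ}
  {F : Type*} [NormedAddCommGroup F]

lemma extZero_eventuallyEq {f : ClosureOf D → F} {g : Euc d → F}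
    (h : ∀ x : D, f (toClosure x) = g x) {x : Euc d} (hx : x ∈ D) : extZero f =ᶠ[nhds x] g := by
  filter_upwards [D.isOpen.mem_nhds hx] with y hy
  exact (extZero_apply f ⟨y, hy⟩).trans (h ⟨y, hy⟩)

lemma IsBoundedLipschitzDomain.compactSpace_closureOf (hD : IsBoundedLipschitzDomain D) :
    CompactSpace (ClosureOf D) :=
  isCompact_iff_compactSpace.1 hD.bounded.isCompact_closure

variable [NormedSpace ℝ F]

namespace CkBar

lemma derivExt_toClosure (f : CkBar D s F) (j : Fin (s + 1)) {x : Euc d} (hx : x ∈ D) :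
    f.derivExt j (toClosure ⟨x, hx⟩) = iteratedFDeriv ℝ j (extZero f) x :=
  f.derivExt_spec j ⟨x, hx⟩

lemma contDiffAt (f : CkBar D s F) {x : Euc d} (hx : x ∈ D) : ContDiffAt ℝ s (extZero f) x :=
  f.2.1.contDiffAt (D.isOpen.mem_nhds hx)

/-- The norm involves extended derivatives on `D̄`; by density of `D` and continuity, bounds on the
actual derivatives inside `D` suffice. -/
lemma norm_le_of_iteratedFDeriv (f : CkBar D s F) {δ : ℝ} (hδ : 0 ≤ δ)
    (h : ∀ j ≤ s, ∀ x ∈ D, ‖iteratedFDeriv ℝ j (extZero f) x‖ ≤ δ) : ‖f‖ ≤ (s + 1) * δ := by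
  rw [norm_def]
  refine (Finset.sum_le_card_nsmul _ _ δ fun j _ => ?_).trans (by simp)
  refine (BoundedContinuousFunction.norm_le hδ).2 fun x => ?_
  have hcl : IsClosed {x : ClosureOf D | ‖f.derivExt j x‖ ≤ δ} :=
    isClosed_le (f.derivExt j).continuous.norm continuous_const
  refine toClosure_dense.induction_on x hcl fun y => ?_
  rw [derivExt_toClosure f j y.2]
  exact h j (Nat.lt_succ_iff.1 j.2) y y.2

lemma norm_iteratedFDeriv_le (f : CkBar D s F) {j : ℕ} (hj : j ≤ s) {x : Euc d} (hx : x ∈ D) :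
    ‖iteratedFDeriv ℝ j (extZero f) x‖ ≤ ‖f‖ := by
  rw [norm_def, ← derivExt_toClosure f ⟨j, Nat.lt_succ_iff.2 hj⟩ hx]
  exact ((f.derivExt _).norm_coe_le_norm _).trans
    (Finset.single_le_sum (f := fun j => ‖f.derivExt j‖) (fun j _ => norm_nonneg (f.derivExt j))
      (Finset.mem_univ _))

lemma norm_apply_le (f : CkBar D s F) (x : ClosureOf D) : ‖f x‖ ≤ ‖f‖ := by
  have hcl : IsClosed {x : ClosureOf D | ‖f x‖ ≤ ‖f‖} :=
    isClosed_le f.toBCF.continuous.norm continuous_const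
  refine toClosure_dense.induction_on x hcl fun y => ?_
  have := f.norm_iteratedFDeriv_le (Nat.zero_le s) y.2
  rwa [norm_iteratedFDeriv_zero, extZero_apply] at this

lemma coe_sub (f g : CkBar D s F) (x : ClosureOf D) : (f - g) x = f x - g x := rfl

lemma smul_apply (c : ℝ) (f : CkBar D s F) (x : ClosureOf D) : (c • f) x = c • f x := rfl

lemma sum_apply {ι : Type*} (T : Finset ι) (f : ι → CkBar D s F) (x : ClosureOf D) :
    (∑ i ∈ T, f i) x = ∑ i ∈ T, f i x := by
  classical
  induction T using Finset.induction_on with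
  | empty => rfl
  | insert i T hi ih =>
    rw [Finset.sum_insert hi, Finset.sum_insert hi, ← ih]
    rfl

lemma ext_toClosure {f g : CkBar D s F} (h : ∀ x : D, f (toClosure x) = g (toClosure x)) :
    f = g :=
  Subtype.ext (DFunLike.coe_injective
    (toClosure_dense.equalizer f.toBCF.continuous g.toBCF.continuous (funext h)))

lemma norm_sub_le_of_iteratedFDeriv (f g : CkBar D s F) {G : Euc d → F} {δ : ℝ} (hδ : 0 ≤ δ)
    (hg : ∀ x : D, g (toClosure x) = G x)
    (h : ∀ j ≤ s, ∀ x ∈ D, ‖iteratedFDeriv ℝ j (fun y => extZero f y - G y) x‖ ≤ δ) :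
    ‖f - g‖ ≤ (s + 1) * δ := by
  refine norm_le_of_iteratedFDeriv _ hδ fun j hj x hx => ?_
  rw [(extZero_eventuallyEq (g := fun y => extZero f y - G y) (fun y => by
    rw [coe_sub, hg, extZero_apply]) hx).iteratedFDeriv ℝ j |>.eq_of_nhds]
  exact h j hj x hx

/-- The derivatives extend continuously to the compact set `D̄`, hence are uniformly continuous.
This controls the error made by small translations. -/
lemma uniform_iteratedFDeriv [CompactSpace (ClosureOf D)] (f : CkBar D s F) {ε : ℝ} (hε : 0 < ε) :
    ∃ δ > 0, ∀ j ≤ s, ∀ x ∈ D, ∀ y ∈ D, dist x y < δ →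
      dist (iteratedFDeriv ℝ j (extZero f) x) (iteratedFDeriv ℝ j (extZero f) y) ≤ ε := by
  have h (j : Fin (s + 1)) : ∀ᶠ δ in nhdsWithin (0 : ℝ) (Ioi 0), ∀ x ∈ D, ∀ y ∈ D, dist x y < δ →
      dist (iteratedFDeriv ℝ j (extZero f) x) (iteratedFDeriv ℝ j (extZero f) y) ≤ ε := by
    obtain ⟨δ, hδ, h⟩ := Metric.uniformContinuous_iff.1
      (CompactSpace.uniformContinuous_of_continuous (f.derivExt j).continuous) ε hε
    filter_upwards [Ioo_mem_nhdsGT hδ] with t ht x hx y hy hxy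
    rw [← derivExt_toClosure f j hx, ← derivExt_toClosure f j hy]
    exact (h (a := toClosure ⟨x, hx⟩) (b := toClosure ⟨y, hy⟩) (hxy.trans ht.2)).le
  obtain ⟨δ, hδ, hpos⟩ := ((Filter.eventually_all.2 h).and self_mem_nhdsWithin).exists
  exact ⟨δ, hpos, fun j hj => hδ ⟨j, Nat.lt_succ_iff.2 hj⟩⟩

/-- The restriction to `D̄` of a `C^s` function on the whole space. -/
lemma exists_restrict [CompactSpace (ClosureOf D)] {G : Euc d → F} (hG : ContDiff ℝ s G) :
    ∃ w : CkBar D s F, ∀ x : ClosureOf D, w x = G x := by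
  let f : ClosureOf D →ᵇ F :=
    BoundedContinuousFunction.mkOfCompact ⟨fun x => G x, hG.continuous.comp continuous_subtype_val⟩
  have hf : ∀ x : D, f (toClosure x) = G x := fun _ => rfl
  refine ⟨⟨f, ?_, fun j hj => ?_⟩, fun _ => rfl⟩
  · refine hG.contDiffOn.congr fun x hx => (extZero_apply f ⟨x, hx⟩)
  · have hc : Continuous (iteratedFDeriv ℝ j G) :=
      hG.continuous_iteratedFDeriv (by exact_mod_cast hj)
    refine ⟨BoundedContinuousFunction.mkOfCompact
      ⟨fun x => iteratedFDeriv ℝ j G x, hc.comp continuous_subtype_val⟩, fun x => ?_⟩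
    exact ((extZero_eventuallyEq hf x.2).iteratedFDeriv ℝ j).eq_of_nhds.symm

end CkBar

end CkBarLemmas

/-! ### Smooth approximation on Lipschitz domains -/

section SmoothApprox

variable {d : ℕ} {D : TopologicalSpace.Opens (Euc d)} {s : ℕ}
  {F : Type*} [NormedAddCommGroup F] [NormedSpace ℝ F]

/-- Near each point of its closure, a Lipschitz domain is mapped into itself by small
translations of its closure in a suitable direction. -/
lemma IsBoundedLipschitzDomain.exists_shift (hD : IsBoundedLipschitzDomain D) {p : Euc d}
    (hp : p ∈ closure (D : Set (Euc d))) :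
    ∃ ρ > 0, ∃ (e : Euc d), ∃ t₀ > 0, ∀ x ∈ closure (D : Set (Euc d)), x ∈ Metric.ball p ρ →
      ∀ t : ℝ, 0 < t → t < t₀ → x + t • e ∈ D := by
  by_cases hpD : p ∈ D
  · obtain ⟨ρ, hρ, h⟩ := Metric.isOpen_iff.1 D.isOpen p hpD
    exact ⟨ρ, hρ, 0, 1, one_pos, fun x _ hx t _ _ => by simpa using h hx⟩
  · have hpf : p ∈ frontier (D : Set (Euc d)) := ⟨hp, by rwa [D.isOpen.interior_eq]⟩
    obtain ⟨e, he, ρ, hρ, M, γ, hγ, h⟩ := hD.lipschitz p hpf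
    -- Halving the radius keeps both `x` and `x + t • e` in the ball of the graph description.
    -- Points of the closure satisfy the weak inequality there, and moving up by `t > 0` makes it
    -- strict.
    refine ⟨ρ / 2, by positivity, e, ρ / 2, by positivity, fun x hx hxp t ht ht' => ?_⟩
    have hle : γ (x - ⟪e, x⟫ • e) ≤ ⟪e, x⟫ := by
      have hcl : IsClosed {y : Euc d | γ (y - ⟪e, y⟫ • e) ≤ ⟪e, y⟫} := by
        have := hγ.continuous
        exact isClosed_le (by fun_prop) (by fun_prop)
      have hsub : (Metric.ball p ρ ∩ D : Set (Euc d)) ⊆ {y | γ (y - ⟪e, y⟫ • e) ≤ ⟪e, y⟫} :=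
        fun y hy => ((h y hy.1).1 hy.2).le
      exact closure_minimal hsub hcl (Metric.isOpen_ball.inter_closure
        ⟨Metric.ball_subset_ball (by linarith) hxp, hx⟩)
    have hee : ⟪e, e⟫ = 1 := by rw [real_inner_self_eq_norm_sq, he]; norm_num
    have hin : ⟪e, x + t • e⟫ = ⟪e, x⟫ + t := by
      rw [inner_add_right, inner_smul_right, hee, mul_one]
    have hball : x + t • e ∈ Metric.ball p ρ := by
      rw [Metric.mem_ball, dist_eq_norm] at hxp ⊢
      calc ‖x + t • e - p‖ = ‖(x - p) + t • e‖ := by congr 1; abel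
        _ ≤ ‖x - p‖ + ‖t • e‖ := norm_add_le _ _
        _ < ρ := by rw [norm_smul, he, Real.norm_of_nonneg ht.le]; linarith
    refine (h _ hball).2 ?_
    rw [hin, show x + t • e - (⟪e, x⟫ + t) • e = x - ⟪e, x⟫ • e by module]
    linarith

/-- Leibniz rule, with the binomial coefficients summing to `2 ^ j`. It is localized to an open set
because the translated functions are smooth only on part of the space. -/
lemma norm_iteratedFDeriv_smul_le_of_isOpen {E : Type*} [NormedAddCommGroup E] [NormedSpace ℝ E]
    {W : Set E} (hW : IsOpen W) {χ : E → ℝ}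
    {g : E → F} {j : ℕ} (hχ : ContDiffOn ℝ j χ W) (hg : ContDiffOn ℝ j g W) {x : E} (hx : x ∈ W)
    {C δ : ℝ} (hC : ∀ k ≤ j, ‖iteratedFDeriv ℝ k χ x‖ ≤ C)
    (hδ : ∀ k ≤ j, ‖iteratedFDeriv ℝ k g x‖ ≤ δ) :
    ‖iteratedFDeriv ℝ j (fun y => χ y • g y) x‖ ≤ 2 ^ j * (C * δ) := by
  have hC0 : 0 ≤ C := (norm_nonneg _).trans (hC 0 (Nat.zero_le _))
  have h := norm_iteratedFDerivWithin_smul_le hχ hg hW.uniqueDiffOn hx (le_refl (j : WithTop ℕ∞))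
  rw [iteratedFDerivWithin_of_isOpen j hW hx] at h
  refine h.trans ?_
  have hsum : ∑ i ∈ Finset.range (j + 1), (j.choose i : ℝ) * (C * δ) = 2 ^ j * (C * δ) := by
    rw [← Finset.sum_mul]
    congr 1
    exact_mod_cast Nat.sum_range_choose j
  rw [← hsum]
  refine Finset.sum_le_sum fun i hi => ?_
  have hi' : i ≤ j := Nat.lt_succ_iff.1 (Finset.mem_range.1 hi)
  rw [iteratedFDerivWithin_of_isOpen i hW hx, iteratedFDerivWithin_of_isOpen (j - i) hW hx, mul_assoc]
  gcongr
  · exact hC i hi'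
  · exact hδ _ (Nat.sub_le _ _)

/-- A function that is `C^s` near a compact set agrees near that set with a compactly supported
`C^s` function. -/
lemma exists_contDiff_hasCompactSupport_eqOn {K : Set (Euc d)} (hK : IsCompact K) {G : Euc d → F}
    (hG : ∀ x ∈ K, ContDiffAt ℝ s G x) :
    ∃ G' : Euc d → F, ContDiff ℝ s G' ∧ HasCompactSupport G' ∧ ∀ x ∈ K, G' =ᶠ[nhds x] G := by
  have hU : IsOpen {x | ContDiffAt ℝ s G x} :=
    isOpen_iff_eventually.2 fun x (hx : ContDiffAt ℝ s G x) => hx.eventually (by simp)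
  obtain ⟨k, hk, hKk, hkU⟩ := exists_compact_between hK hU hG
  obtain ⟨η, hη1, hη0, -⟩ := exists_contMDiffMap_one_nhds_of_subset_interior
    (modelWithCornersSelf ℝ (Euc d)) (n := ⊤) hK.isClosed hKk
  have hηs : ContDiff ℝ ∞ η := η.contMDiff.contDiff
  refine ⟨fun x => η x • G x, contDiff_iff_contDiffAt.2 fun x => ?_,
    HasCompactSupport.intro hk fun x hx => by rw [hη0 x hx, zero_smul], fun x hx => ?_⟩
  · by_cases hx : ContDiffAt ℝ s G x
    · exact (hηs.contDiffAt.of_le (by exact_mod_cast le_top)).smul hx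
    · have hxk : x ∈ kᶜ := fun h => hx (hkU h)
      refine (contDiffAt_const (c := (0 : F))).congr_of_eventuallyEq ?_
      filter_upwards [hk.isClosed.isOpen_compl.mem_nhds hxk] with y hy
      rw [hη0 y hy, zero_smul]
  · filter_upwards [hη1.filter_mono (nhds_le_nhdsSet hx)] with y hy
    rw [hy, one_smul]

/-- Partition of unity subordinate to a finite family of balls in which small translations map the
closure of the domain into the domain. -/
lemma IsBoundedLipschitzDomain.exists_partition_shift (hD : IsBoundedLipschitzDomain D) :
    ∃ (ι : Type) (_ : Fintype ι) (χ : ι → Euc d → ℝ) (e : ι → Euc d) (t₀ : ℝ), 0 < t₀ ∧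
      (∀ i, ContDiff ℝ ∞ (χ i)) ∧ (∀ x ∈ closure (D : Set (Euc d)), ∑ i, χ i x = 1) ∧
      ∀ i, ∀ x ∈ closure (D : Set (Euc d)), x ∈ tsupport (χ i) → ∀ t : ℝ, 0 < t → t < t₀ →
        x + t • e i ∈ D := by
  choose! ρ hρ e t₀ ht₀ h using fun p (hp : p ∈ closure (D : Set (Euc d))) => hD.exists_shift hp
  obtain ⟨T, hTD, hT⟩ := hD.bounded.isCompact_closure.elim_nhds_subcover (fun p => Metric.ball p (ρ p))
    fun p hp => Metric.ball_mem_nhds p (hρ p hp)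
  obtain ⟨χ, hχ⟩ := SmoothPartitionOfUnity.exists_isSubordinate
    (modelWithCornersSelf ℝ (Euc d)) isClosed_closure (fun i : T => Metric.ball (i : Euc d) (ρ i))
    (fun _ => Metric.isOpen_ball) (by simpa only [iUnion_subtype] using hT)
  obtain ⟨t, ht, htpos⟩ : ∃ t : ℝ, (∀ i : T, t < t₀ i) ∧ 0 < t := by
    refine ((Filter.eventually_all.2 fun i : T => ?_).and
      (self_mem_nhdsWithin : Ioi (0 : ℝ) ∈ nhdsWithin 0 (Ioi 0))).exists
    exact nhdsWithin_le_nhds (Iio_mem_nhds (ht₀ i (hTD i i.2)))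
  let φ := (Fintype.equivFin T).symm
  refine ⟨Fin (Fintype.card T), inferInstance, fun i => χ (φ i), fun i => e (φ i), t, htpos,
    fun i => (χ (φ i)).contMDiff.contDiff, fun x hx => ?_, fun i x hx hxi r hr hrt => ?_⟩
  · rw [φ.sum_comp (fun i => χ i x), ← finsum_eq_sum_of_fintype]
    exact χ.sum_eq_one hx
  · exact h _ (hTD _ (φ i).2) x hx (hχ (φ i) hxi) r hr (hrt.trans (ht _))

/-- On a bounded Lipschitz domain, compactly supported `C^s` functions on the whole space are dense
in `C^s(D̄; F)`. -/
lemma IsBoundedLipschitzDomain.exists_contDiff_near (hD : IsBoundedLipschitzDomain D)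
    (f : CkBar D s F) {ε : ℝ} (hε : 0 < ε) :
    ∃ G : Euc d → F, ContDiff ℝ s G ∧ HasCompactSupport G ∧
      ∀ j ≤ s, ∀ x ∈ D, ‖iteratedFDeriv ℝ j (fun y => extZero f y - G y) x‖ ≤ ε := by
  have := hD.compactSpace_closureOf
  obtain ⟨ι, _, χ, e, t₀, ht₀, hχs, hχ1, hshift⟩ := hD.exists_partition_shift
  have hK := hD.bounded.isCompact_closure
  obtain ⟨C, hC0, hC⟩ : ∃ C > 0, ∀ i, ∀ k ≤ s, ∀ x ∈ D, ‖iteratedFDeriv ℝ k (χ i) x‖ ≤ C := by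
    have h (i : ι) (k : Fin (s + 1)) : ∀ᶠ C : ℝ in Filter.atTop, ∀ x ∈ D,
        ‖iteratedFDeriv ℝ k (χ i) x‖ ≤ C := by
      obtain ⟨C, hC⟩ := hK.exists_bound_of_continuousOn
        ((hχs i).continuous_iteratedFDeriv (m := k) (by exact_mod_cast le_top)).continuousOn
      filter_upwards [Filter.eventually_ge_atTop C] with C' hC' x hx
      exact (hC x (subset_closure hx)).trans hC'
    obtain ⟨C, hC, hpos⟩ := ((Filter.eventually_all.2 fun i => Filter.eventually_all.2 (h i)).and
      (Filter.eventually_gt_atTop 0)).exists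
    exact ⟨C, hpos, fun i k hk => hC i ⟨k, Nat.lt_succ_iff.2 hk⟩⟩
  -- Each of the `N` pieces will contribute at most `2 ^ s * (C * δ)`; the `N + 1` in `δ` avoids
  -- dividing by zero.
  set N : ℝ := (Fintype.card ι : ℝ)
  set δ : ℝ := ε / ((N + 1) * (2 ^ s * C)) with hδ
  have hδpos : 0 < δ := by positivity
  obtain ⟨r, hr, hunif⟩ := f.uniform_iteratedFDeriv hδpos
  obtain ⟨t, ⟨ht, htt₀⟩, htr⟩ : ∃ t : ℝ, (0 < t ∧ t < t₀) ∧ ∀ i, t * ‖e i‖ < r := by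
    have h (i : ι) : ∀ᶠ t : ℝ in nhdsWithin 0 (Ioi 0), t * ‖e i‖ < r := by
      have hc : Continuous fun t : ℝ => t * ‖e i‖ := by fun_prop
      exact nhdsWithin_le_nhds (hc.continuousAt.eventually (gt_mem_nhds (by simpa using hr)))
    exact (Filter.Eventually.and (Ioo_mem_nhdsGT ht₀) (Filter.eventually_all.2 h)).exists
  have hsm (i : ι) {n : ℕ} (x : Euc d) : ContDiffAt ℝ n (χ i) x :=
    (hχs i).contDiffAt.of_le (by exact_mod_cast le_top)
  have hfs (i : ι) {x : Euc d} (hx : x ∈ closure (D : Set (Euc d))) (hxi : x ∈ tsupport (χ i)) :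
      ContDiffAt ℝ s (fun y => extZero f (y + t • e i)) x :=
    ContDiffAt.comp x (f.contDiffAt (hshift i x hx hxi t ht htt₀))
      (contDiff_id.add contDiff_const).contDiffAt
  have hzero (i : ι) {x : Euc d} (hxi : x ∉ tsupport (χ i)) (g : Euc d → F) :
      (fun y => χ i y • g y) =ᶠ[nhds x] fun _ => 0 := by
    filter_upwards [notMem_tsupport_iff_eventuallyEq.1 hxi] with y hy
    rw [hy, Pi.zero_apply, zero_smul]
  -- Each piece `χ i` multiplies `f` translated along its own direction. At points of `D̄` in the
  -- support of `χ i` the translation lands inside `D`, where `f` is `C^s`, so the sum is `C^s` near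
  -- all of `D̄`.
  obtain ⟨G, hG, hGc, hGeq⟩ := exists_contDiff_hasCompactSupport_eqOn (s := s) hK
    (G := fun y => ∑ i, χ i y • extZero f (y + t • e i)) fun x hx => by
      refine ContDiffAt.sum fun i _ => ?_
      by_cases hxi : x ∈ tsupport (χ i)
      · exact (hsm i x).smul (hfs i hx hxi)
      · exact contDiffAt_const.congr_of_eventuallyEq (hzero i hxi _)
  refine ⟨G, hG, hGc, fun j hj x hx => ?_⟩
  have hxc : x ∈ closure (D : Set (Euc d)) := subset_closure hx
  have hloc : (fun y => extZero f y - G y) =ᶠ[nhds x]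
      fun y => ∑ i, χ i y • (extZero f y - extZero f (y + t • e i)) := by
    filter_upwards [hGeq x hxc, D.isOpen.mem_nhds hx] with y hy hyD
    simp_rw [hy, smul_sub, Finset.sum_sub_distrib, ← Finset.sum_smul,
      hχ1 y (subset_closure hyD), one_smul]
  rw [(hloc.iteratedFDeriv ℝ j).eq_of_nhds]
  have hterm (i : ι) : ContDiffAt ℝ j
      (fun y => χ i y • (extZero f y - extZero f (y + t • e i))) x := by
    by_cases hxi : x ∈ tsupport (χ i)
    · exact (hsm i x).smul (((f.contDiffAt hx).sub (hfs i hxc hxi)).of_le (by exact_mod_cast hj))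
    · exact contDiffAt_const.congr_of_eventuallyEq (hzero i hxi _)
  have hbound (i : ι) : ‖iteratedFDeriv ℝ j
      (fun y => χ i y • (extZero f y - extZero f (y + t • e i))) x‖ ≤ 2 ^ s * (C * δ) := by
    by_cases hxi : x ∈ tsupport (χ i)
    · have hxe := hshift i x hxc hxi t ht htt₀
      let W : Set (Euc d) := D ∩ (fun y => y + t • e i) ⁻¹' D
      have hW : IsOpen W := D.isOpen.inter (D.isOpen.preimage (by fun_prop))
      have hd1 : ∀ y ∈ W, ContDiffAt ℝ j (extZero f) y := fun y hy =>
        (f.contDiffAt hy.1).of_le (by exact_mod_cast hj)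
      have hd2 : ∀ y ∈ W, ContDiffAt ℝ j (fun y => extZero f (y + t • e i)) y := fun y hy =>
        ContDiffAt.comp y ((f.contDiffAt hy.2).of_le (by exact_mod_cast hj))
          (contDiff_id.add contDiff_const).contDiffAt
      refine (norm_iteratedFDeriv_smul_le_of_isOpen hW (x := x) (C := C) (δ := δ)
        (fun y _ => (hsm i y).contDiffWithinAt)
        (fun y hy => ((hd1 y hy).sub (hd2 y hy)).contDiffWithinAt) ⟨hx, hxe⟩
        (fun k hk => hC i k (hk.trans hj) x hx) (fun k hk => ?_)).trans ?_
      · have hk' : (k : WithTop ℕ∞) ≤ j := by exact_mod_cast hk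
        rw [fun_iteratedFDeriv_sub_apply ((hd1 x ⟨hx, hxe⟩).of_le hk')
          ((hd2 x ⟨hx, hxe⟩).of_le hk'), iteratedFDeriv_comp_add_right, ← dist_eq_norm]
        refine hunif k (hk.trans hj) x hx _ hxe ?_
        rw [dist_self_add_right, norm_smul, Real.norm_of_nonneg ht.le]
        exact htr i
      · gcongr
        norm_num
    · rw [((hzero i hxi _).iteratedFDeriv ℝ j).eq_of_nhds, iteratedFDeriv_fun_zero]
      simp only [Pi.zero_apply, norm_zero]
      positivity
  rw [iteratedFDeriv_fun_sum_apply (fun i _ => hterm i)]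
  refine (norm_sum_le_of_le _ fun i _ => hbound i).trans ?_
  rw [Finset.sum_const, nsmul_eq_mul, Finset.card_univ, hδ]
  have hN : 0 ≤ N := Nat.cast_nonneg _
  rw [show N * (2 ^ s * (C * (ε / ((N + 1) * (2 ^ s * C))))) = N / (N + 1) * ε by field_simp]
  exact mul_le_of_le_one_left hε.le ((div_le_one (by positivity)).2 (by linarith))

end SmoothApprox

/-! ### Density of exponentials in `C^s` -/

section ExpDense

variable {d : ℕ} {D : TopologicalSpace.Opens (Euc d)} {s : ℕ}
  {F : Type*} [NormedAddCommGroup F] [NormedSpace ℝ F]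

/-- Stone–Weierstrass for exponentials of linear functionals on a compact set. -/
lemma exists_sum_exp_inner_near {K : Set (Euc d)} (hK : IsCompact K) {φ : Euc d → ℝ}
    (hφ : Continuous φ) {ε : ℝ} (hε : 0 < ε) :
    ∃ (n : ℕ) (a : Fin n → ℝ) (q : Fin n → Euc d), ∀ x ∈ K,
      |φ x - ∑ i, a i * Real.exp ⟪q i, x⟫| ≤ ε := by
  have : CompactSpace K := isCompact_iff_compactSpace.1 hK
  let S : Submodule ℝ C(K, ℝ) :=
    { carrier := {l | ∃ q : Euc d, ∀ x : K, l x = ⟪q, x⟫}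
      zero_mem' := ⟨0, by simp⟩
      add_mem' := by
        rintro l l' ⟨q, hq⟩ ⟨q', hq'⟩
        exact ⟨q + q', fun x => by simp [hq, hq', inner_add_left]⟩
      smul_mem' := by
        rintro c l ⟨q, hq⟩
        exact ⟨c • q, fun x => by simp [hq, inner_smul_left]⟩ }
  obtain ⟨n, a, l, hl, h⟩ := exists_sum_exp_near S (fun x y hxy => by
    refine ⟨⟨fun z => ⟪(x : Euc d) - y, z⟫, by fun_prop⟩, ⟨_, fun _ => rfl⟩, fun h => hxy ?_⟩
    have h' : ⟪(x : Euc d) - y, (x : Euc d) - y⟫ = 0 := by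
      rw [inner_sub_right, sub_eq_zero]
      exact h
    exact Subtype.ext (sub_eq_zero.1 (inner_self_eq_zero.1 h'))) ⟨fun x => φ x, by fun_prop⟩ hε
  choose q hq using hl
  refine ⟨n, a, q, fun x hx => ?_⟩
  have := h ⟨x, hx⟩
  simpa only [hq, ContinuousMap.coe_mk] using this

-- All derivatives fall on `G`, so `P` need only be continuous and no control of the derivatives of
-- its approximation error is required.
open ContinuousLinearMap in
lemma iteratedFDeriv_convolution_right {P : Euc d → ℝ} (hP : Continuous P) {G : Euc d → F}
    (hG : ContDiff ℝ s G) (hGc : HasCompactSupport G) {j : ℕ} (hj : j ≤ s) :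
    iteratedFDeriv ℝ j (convolution P G (lsmul ℝ ℝ) volume) =
      convolution P (iteratedFDeriv ℝ j G) (lsmul ℝ ℝ) volume := by
  induction j with
  | zero =>
    funext x
    rw [iteratedFDeriv_zero_eq_comp]
    simp only [convolution, Function.comp_apply, lsmul_apply, iteratedFDeriv_zero_eq_comp, ← map_smul]
    exact ((continuousMultilinearCurryFin0 ℝ (Euc d) F).symm.toContinuousLinearEquiv.integral_comp_comm
      _).symm
  | succ j ih =>
    have hd : ContDiff ℝ 1 (iteratedFDeriv ℝ j G) :=
      hG.iteratedFDeriv_right (by exact_mod_cast (by omega : 1 + j ≤ s))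
    have hcs : HasCompactSupport (iteratedFDeriv ℝ j G) := hGc.iteratedFDeriv j
    funext x
    rw [iteratedFDeriv_succ_eq_comp_left, iteratedFDeriv_succ_eq_comp_left, Function.comp_apply,
      ih (by omega),
      (hcs.hasFDerivAt_convolution_right (lsmul ℝ ℝ) hP.locallyIntegrable hd x).fderiv]
    simp only [convolution, Function.comp_apply, lsmul_apply, ← map_smul]
    exact (ContinuousLinearEquiv.integral_comp_comm (𝕜 := ℝ) (X := Euc d) (μ := volume)
      (E := Euc d →L[ℝ] ContinuousMultilinearMap ℝ (fun _ : Fin j => Euc d) F)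
      (F := ContinuousMultilinearMap ℝ (fun _ : Fin (j + 1) => Euc d) F)
      (continuousMultilinearCurryLeftEquiv ℝ (fun _ : Fin (j + 1) => Euc d)
        F).symm.toContinuousLinearEquiv _).symm

-- The factorization `exp⟪q, x - y⟫ = exp⟪q, x⟫ exp(-⟪q, y⟫)` makes convolution with a combination
-- of exponentials again a combination of exponentials.
open ContinuousLinearMap in
lemma convolution_sum_exp {n : ℕ} (a : Fin n → ℝ) (q : Fin n → Euc d) {G : Euc d → F}
    (hG : Continuous G) (hGc : HasCompactSupport G) (x : Euc d) :
    convolution (fun y => ∑ i, a i * Real.exp ⟪q i, y⟫) G (lsmul ℝ ℝ) volume x =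
      ∑ i, Real.exp ⟪q i, x⟫ • (a i • ∫ y, Real.exp (-⟪q i, y⟫) • G y) := by
  rw [convolution_eq_swap]
  simp only [lsmul_apply, Finset.sum_smul]
  rw [integral_finsetSum]
  · refine Finset.sum_congr rfl fun i _ => ?_
    rw [← integral_smul, ← integral_smul]
    congr 1
    funext y
    rw [inner_sub_right, sub_eq_add_neg, Real.exp_add, smul_smul, smul_smul]
    congr 1
    ring
  · intro i _
    exact Continuous.integrable_of_hasCompactSupport (by fun_prop) hGc.smul_left

/-- Comparison of a function with its convolution with an approximation of a bump function. -/
lemma norm_sub_convolution_le {H : Euc d → F} [CompleteSpace F] (hH : Continuous H)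
    (hHc : HasCompactSupport H)
    {R R₀ : ℝ} (hR₀ : tsupport H ⊆ Metric.closedBall 0 R₀) (φ : ContDiffBump (0 : Euc d))
    {P : Euc d → ℝ} (hP : Continuous P) {η δ : ℝ}
    (hφP : ∀ t ∈ Metric.closedBall (0 : Euc d) (R + R₀), |φ.normed volume t - P t| ≤ η)
    {x : Euc d} (hx : ‖x‖ ≤ R) (hδ : ∀ y ∈ Metric.ball x φ.rOut, dist (H y) (H x) ≤ δ) :
    ‖H x - convolution P H (ContinuousLinearMap.lsmul ℝ ℝ) volume x‖ ≤ δ + η * ∫ y, ‖H y‖ := by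
  have h1 : dist (convolution (φ.normed volume) H (ContinuousLinearMap.lsmul ℝ ℝ) volume x) (H x)
      ≤ δ := φ.dist_normed_convolution_le hH.aestronglyMeasurable hδ
  have hint {ψ : Euc d → ℝ} (hψ : Continuous ψ) : Integrable fun t => ψ t • H (x - t) := by
    refine Continuous.integrable_of_hasCompactSupport (by fun_prop) ?_
    exact (hHc.comp_homeomorph (Homeomorph.subLeft x)).smul_left
  have h2 : dist (convolution (φ.normed volume) H (ContinuousLinearMap.lsmul ℝ ℝ) volume x)
      (convolution P H (ContinuousLinearMap.lsmul ℝ ℝ) volume x) ≤ η * ∫ y, ‖H y‖ := by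
    have hφc : Continuous (φ.normed volume) := (φ.contDiff_normed (n := 0)).continuous
    rw [dist_eq_norm]
    simp only [convolution, ContinuousLinearMap.lsmul_apply]
    rw [← integral_sub (hint hφc) (hint hP)]
    simp only [← sub_smul]
    have hle : ∀ t, ‖(φ.normed volume t - P t) • H (x - t)‖ ≤ η * ‖H (x - t)‖ := by
      intro t
      rw [norm_smul]
      by_cases hz : x - t ∈ tsupport H
      · gcongr
        refine hφP t ?_
        rw [mem_closedBall_zero_iff]
        have := mem_closedBall_zero_iff.1 (hR₀ hz)
        calc ‖t‖ = ‖x - (x - t)‖ := by congr 1; abel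
          _ ≤ ‖x‖ + ‖x - t‖ := norm_sub_le _ _
          _ ≤ R + R₀ := add_le_add hx this
      · rw [image_eq_zero_of_notMem_tsupport hz, norm_zero, mul_zero, mul_zero]
    refine (norm_integral_le_of_norm_le (g := fun t => η * ‖H (x - t)‖)
      ?_ (Filter.Eventually.of_forall hle)).trans ?_
    · have := (hint (ψ := fun _ => 1) continuous_const).norm.const_mul η
      simpa using this
    · rw [integral_const_mul, integral_sub_left_eq_self (fun y => ‖H y‖)]
  rw [← dist_eq_norm]
  exact (dist_triangle_left _ _ _).trans (add_le_add h1 h2)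

lemma contDiff_sum_exp_inner {m : WithTop ℕ∞} {n : ℕ} (q : Fin n → Euc d) (a : Fin n → F) :
    ContDiff ℝ m fun y => ∑ i, Real.exp ⟪q i, y⟫ • a i :=
  ContDiff.sum fun _ _ => (contDiff_const.inner ℝ contDiff_id).exp.smul contDiff_const

/-- Compactly supported `C^s` functions are approximated in `C^s` on bounded sets by combinations
of exponentials. -/
lemma exists_sum_exp_near_contDiff [CompleteSpace F] {G : Euc d → F}
    (hG : ContDiff ℝ s G) (hGc : HasCompactSupport G) (R : ℝ) {ε : ℝ} (hε : 0 < ε) :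
    ∃ (n : ℕ) (q : Fin n → Euc d) (a : Fin n → F), ∀ j ≤ s, ∀ x : Euc d, ‖x‖ ≤ R →
      ‖iteratedFDeriv ℝ j (fun y => G y - ∑ i, Real.exp ⟪q i, y⟫ • a i) x‖ ≤ ε := by
  have hcont {j : ℕ} (hj : j ≤ s) : Continuous (iteratedFDeriv ℝ j G) :=
    hG.continuous_iteratedFDeriv (by exact_mod_cast hj)
  obtain ⟨δ, hδ, hδpos⟩ : ∃ δ : ℝ, (∀ j : Fin (s + 1), ∀ x y : Euc d, dist x y < δ →
      dist (iteratedFDeriv ℝ j G x) (iteratedFDeriv ℝ j G y) ≤ ε / 2) ∧ 0 < δ := by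
    refine ((Filter.eventually_all.2 fun j : Fin (s + 1) => ?_).and
      (self_mem_nhdsWithin : Ioi (0 : ℝ) ∈ nhdsWithin 0 (Ioi 0))).exists
    obtain ⟨δ, hδ, h⟩ := Metric.uniformContinuous_iff.1
      ((hGc.iteratedFDeriv (𝕜 := ℝ) j).uniformContinuous_of_continuous
        (hcont (Nat.lt_succ_iff.1 j.2))) (ε / 2) (by positivity)
    filter_upwards [Ioo_mem_nhdsGT hδ] with t ht x y hxy
    exact (h (hxy.trans ht.2)).le
  let φ : ContDiffBump (0 : Euc d) := ⟨δ / 2, δ, by positivity, by linarith⟩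
  obtain ⟨R₀, hR₀⟩ := hGc.isCompact.isBounded.subset_closedBall (0 : Euc d)
  set I : ℝ := ∑ j ∈ Finset.range (s + 1), ∫ y, ‖iteratedFDeriv ℝ j G y‖ with hI
  have hI0 : 0 ≤ I := Finset.sum_nonneg fun j _ => integral_nonneg fun _ => norm_nonneg _
  set η : ℝ := ε / 2 / (I + 1) with hη
  have hηpos : 0 < η := by positivity
  -- For `‖x‖ ≤ R` and `x - t` in the support of `G` one has `‖t‖ ≤ R + R₀`, so the mollifier need
  -- be approximated only on this ball. The accuracy `η` is set so that `η * I ≤ ε / 2`, with `I`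
  -- bounding the `L¹` norms of all derivatives of `G`.
  obtain ⟨n, a, q, hP⟩ := exists_sum_exp_inner_near (isCompact_closedBall (0 : Euc d) (R + R₀))
    (φ.contDiff_normed (n := 0) (μ := volume)).continuous hηpos
  set P : Euc d → ℝ := fun y => ∑ i, a i * Real.exp ⟪q i, y⟫ with hPdef
  have hPc : Continuous P := by fun_prop
  set b : Fin n → F := fun i => a i • ∫ y, Real.exp (-⟪q i, y⟫) • G y with hb
  refine ⟨n, q, b, fun j hj x hx => ?_⟩
  have hPG : (fun y => ∑ i, Real.exp ⟪q i, y⟫ • b i) =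
      convolution P G (ContinuousLinearMap.lsmul ℝ ℝ) volume :=
    funext fun y => (convolution_sum_exp a q hG.continuous hGc y).symm
  have hjs : (j : WithTop ℕ∞) ≤ s := by exact_mod_cast hj
  rw [fun_iteratedFDeriv_sub_apply (hG.of_le hjs).contDiffAt
    (contDiff_sum_exp_inner q b).contDiffAt, hPG, iteratedFDeriv_convolution_right hPc hG hGc hj]
  refine (norm_sub_convolution_le (hcont hj) (hGc.iteratedFDeriv j)
    ((tsupport_iteratedFDeriv_subset j).trans hR₀) φ hPc hP hx
    fun y hy => hδ ⟨j, Nat.lt_succ_iff.2 hj⟩ y x hy).trans ?_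
  have hle : ∫ y, ‖iteratedFDeriv ℝ j G y‖ ≤ I :=
    Finset.single_le_sum (f := fun j => ∫ y, ‖iteratedFDeriv ℝ j G y‖)
      (fun j _ => integral_nonneg fun _ => norm_nonneg _)
      (Finset.mem_range.2 (Nat.lt_succ_iff.2 hj))
  calc ε / 2 + η * ∫ y, ‖iteratedFDeriv ℝ j G y‖ ≤ ε / 2 + η * (I + 1) := by gcongr; linarith
    _ = ε := by rw [hη]; field_simp; norm_num

/-- Combinations of exponentials are dense in `C^s(D̄; F)` for a bounded Lipschitz domain `D`. -/
lemma IsBoundedLipschitzDomain.exists_sum_exp_near [CompleteSpace F]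
    (hD : IsBoundedLipschitzDomain D) (f : CkBar D s F) {ε : ℝ} (hε : 0 < ε) :
    ∃ (n : ℕ) (q : Fin n → Euc d) (a : Fin n → F), ∀ w : CkBar D s F,
      (∀ x : D, w (toClosure x) = ∑ i, Real.exp ⟪q i, (x : Euc d)⟫ • a i) → ‖f - w‖ ≤ ε := by
  set δ : ℝ := ε / (s + 1) / 2 with hδ
  have hδpos : 0 < δ := by positivity
  obtain ⟨G, hG, hGc, hfG⟩ := hD.exists_contDiff_near f hδpos
  obtain ⟨R, hR⟩ := hD.bounded.subset_closedBall (0 : Euc d)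
  obtain ⟨n, q, a, h⟩ := exists_sum_exp_near_contDiff hG hGc R hδpos
  refine ⟨n, q, a, fun w hw => ?_⟩
  have hle : (s + 1) * (2 * δ) = ε := by rw [hδ]; field_simp
  rw [← hle]
  refine CkBar.norm_sub_le_of_iteratedFDeriv f w
    (G := fun y => ∑ i, Real.exp ⟪q i, y⟫ • a i) (by positivity) hw fun j hj x hx => ?_
  have hjs : (j : WithTop ℕ∞) ≤ s := by exact_mod_cast hj
  have hE : ContDiffAt ℝ j (fun y => ∑ i, Real.exp ⟪q i, y⟫ • a i) x :=
    (contDiff_sum_exp_inner q a).contDiffAt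
  have h1 := (f.contDiffAt hx).of_le hjs
  have h2 := hG.contDiffAt (x := x).of_le hjs
  have e : (fun y => extZero f y - ∑ i, Real.exp ⟪q i, y⟫ • a i) =
      fun y => (extZero f y - G y) + (G y - ∑ i, Real.exp ⟪q i, y⟫ • a i) := by
    funext y; abel
  rw [e, fun_iteratedFDeriv_add_apply (h1.sub h2) (h2.sub hE), two_mul]
  exact norm_add_le_of_le (hfG j hj x hx) (h j hj x (mem_closedBall_zero_iff.1 (hR hx)))

end ExpDense

/-! ### Averages of ridge functions separate points -/

section Averages

variable {d r : ℕ} {D : TopologicalSpace.Opens (Euc d)}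

lemma continuous_toClosure : Continuous (toClosure (D := D)) :=
  continuous_subtype_val.subtype_mk _

lemma isFiniteMeasure_opens (hD : Bornology.IsBounded (D : Set (Euc d))) :
    IsFiniteMeasure (volume : Measure D) :=
  ⟨by
    rw [show (volume : Measure D) univ = volume (D : Set (Euc d)) from
      Measure.Subtype.volume_univ D.isOpen.measurableSet.nullMeasurableSet]
    exact hD.measure_lt_top⟩

lemma isOpenPosMeasure_opens : (volume : Measure D).IsOpenPosMeasure :=
  Measure.IsOpenPosMeasure.comap volume D.isOpenEmbedding'

lemma integrable_comp_toClosure (hD : IsBoundedLipschitzDomain D) {F : Type*}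
    [NormedAddCommGroup F] {g : ClosureOf D → F} (hg : Continuous g) :
    Integrable (fun x : D => g (toClosure x)) := by
  have := hD.compactSpace_closureOf
  have := isFiniteMeasure_opens hD.bounded
  obtain ⟨C, hC⟩ := isCompact_univ.exists_bound_of_continuousOn hg.continuousOn
  exact Integrable.of_bound (hg.comp continuous_toClosure).aestronglyMeasurable
    C (Filter.Eventually.of_forall fun x => hC _ (mem_univ _))

lemma abs_integral_sub_le (hD : IsBoundedLipschitzDomain D) {f g : D → ℝ} (hf : Integrable f)
    (hg : Integrable g) {ε : ℝ} (h : ∀ x, |f x - g x| ≤ ε) :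
    |(∫ x, f x) - ∫ x, g x| ≤ ε * (volume : Measure D).real univ := by
  have := isFiniteMeasure_opens hD.bounded
  rw [← integral_sub hf hg]
  exact norm_integral_le_of_norm_le_const 
    (Filter.Eventually.of_forall fun x => (Real.norm_eq_abs _).trans_le (h x))

/-- Integrals of combinations of ridge functions determine integrals of exponentials. -/
lemma integral_exp_eq_of_integral_ridge_eq (hD : IsBoundedLipschitzDomain D) {σ : ℝ → ℝ}
    (hσ : ContDiff ℝ ∞ σ) (hσp : ¬ ∃ p : ℝ[X], ∀ x : ℝ, σ x = p.eval x)
    {g g' : ClosureOf D → ℝ} (hg : Continuous g) (hg' : Continuous g')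
    (h : ∀ lam b : ℝ, ∫ x : D, σ (lam * g (toClosure x) + b) =
      ∫ x : D, σ (lam * g' (toClosure x) + b)) :
    ∫ x : D, Real.exp (g (toClosure x)) = ∫ x : D, Real.exp (g' (toClosure x)) := by
  have := hD.compactSpace_closureOf
  obtain ⟨R, hR⟩ := isCompact_univ.exists_bound_of_continuousOn hg.continuousOn
  obtain ⟨R', hR'⟩ := isCompact_univ.exists_bound_of_continuousOn hg'.continuousOn
  set V := (volume : Measure D).real univ
  have hV : 0 ≤ V := measureReal_nonneg
  refine eq_of_abs_sub_le_all fun ε hε => ?_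
  obtain ⟨n, a, lam, b, hφ⟩ := exists_sum_ridge_near_exp hσ hσp (max R R') 0
    (ε := ε / (2 * (V + 1))) (by positivity)
  have key {f : ClosureOf D → ℝ} (hf : Continuous f) (hfR : ∀ x, |f x| ≤ max R R') :
      |(∫ x : D, Real.exp (f (toClosure x))) -
        ∑ i, a i * ∫ x : D, σ (lam i * f (toClosure x) + b i)| ≤ ε / 2 := by
    have hint (i : Fin n) : Integrable fun x : D => σ (lam i * f (toClosure x) + b i) := by
      have := hσ.continuous
      exact integrable_comp_toClosure hD (g := fun x => σ (lam i * f x + b i)) (by fun_prop)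
    have hsum : ∑ i, a i * ∫ x : D, σ (lam i * f (toClosure x) + b i) =
        ∫ x : D, ∑ i, a i * σ (lam i * f (toClosure x) + b i) := by
      rw [integral_finsetSum _ fun i _ => (hint i).const_mul _]
      simp_rw [integral_const_mul]
    rw [hsum]
    refine (abs_integral_sub_le hD
      (integrable_comp_toClosure hD (g := fun x => Real.exp (f x)) (by fun_prop))
      (integrable_finsetSum _ fun i _ => (hint i).const_mul _)
      (fun x => by simpa using hφ 0 le_rfl _ (hfR (toClosure x)))).trans ?_
    calc ε / (2 * (V + 1)) * V ≤ ε / (2 * (V + 1)) * (V + 1) := by gcongr; linarith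
      _ = ε / 2 := by field_simp
  have h1 := key hg fun x => (hR x (mem_univ _)).trans (le_max_left _ _)
  have h2 := key hg' fun x => (hR' x (mem_univ _)).trans (le_max_right _ _)
  simp_rw [← h] at h2
  rw [abs_le] at h1 h2 ⊢
  constructor <;> linarith

/-- Averages of ridge functions of `(u(x), x)` separate continuous functions `u`. -/
lemma eq_of_integral_ridge_eq (hD : IsBoundedLipschitzDomain D) {σ : ℝ → ℝ}
    (hσ : ContDiff ℝ ∞ σ) (hσp : ¬ ∃ p : ℝ[X], ∀ x : ℝ, σ x = p.eval x)
    {u u' : ClosureOf D → Euc r} (hu : Continuous u) (hu' : Continuous u')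
    (h : ∀ (w : (Euc r × Euc d) →L[ℝ] ℝ) (b : ℝ), ∫ x : D, σ (w (u (toClosure x), x) + b) =
      ∫ x : D, σ (w (u' (toClosure x), x) + b)) (x : D) : u (toClosure x) = u' (toClosure x) := by
  have := hD.compactSpace_closureOf
  have := isFiniteMeasure_opens hD.bounded
  have := isOpenPosMeasure_opens (D := D)
  -- The scale `lam` of a ridge function is absorbed into the functional `w`.
  have hexp (w : (Euc r × Euc d) →L[ℝ] ℝ) : ∫ x : D, Real.exp (w (u (toClosure x), x)) =
      ∫ x : D, Real.exp (w (u' (toClosure x), x)) :=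
    integral_exp_eq_of_integral_ridge_eq hD hσ hσp
      (g := fun x => w (u x, (x : Euc d))) (g' := fun x => w (u' x, (x : Euc d)))
      (by fun_prop) (by fun_prop) fun lam b => h (lam • w) b
  obtain ⟨R, hR⟩ := isCompact_univ.exists_bound_of_continuousOn hu.continuousOn
  obtain ⟨R', hR'⟩ := isCompact_univ.exists_bound_of_continuousOn hu'.continuousOn
  have hXc : CompactSpace (Metric.closedBall (0 : Euc r) (max R R')) :=
    isCompact_iff_compactSpace.1 (isCompact_closedBall _ _)
  let S : Submodule ℝ C(Metric.closedBall (0 : Euc r) (max R R') × ClosureOf D, ℝ) :=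
    { carrier := {l | ∃ w : (Euc r × Euc d) →L[ℝ] ℝ,
        ∀ p : Metric.closedBall (0 : Euc r) (max R R') × ClosureOf D, l p = w (p.1, p.2)}
      zero_mem' := ⟨0, by simp⟩
      add_mem' := by
        rintro l l' ⟨w, hw⟩ ⟨w', hw'⟩
        exact ⟨w + w', fun p => by simp [hw, hw']⟩
      smul_mem' := by
        rintro c l ⟨w, hw⟩
        exact ⟨c • w, fun p => by simp [hw]⟩ }
  have hS (p p' : Metric.closedBall (0 : Euc r) (max R R') × ClosureOf D) (hne : p ≠ p') :
      ∃ l ∈ S, l p ≠ l p' := by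
    have hne' : ((p.1 : Euc r), (p.2 : Euc d)) ≠ ((p'.1 : Euc r), (p'.2 : Euc d)) := by
      intro e
      rw [Prod.mk.injEq] at e
      exact hne (Prod.ext (Subtype.ext e.1) (Subtype.ext e.2))
    obtain ⟨w, hw⟩ := SeparatingDual.exists_separating_of_ne (R := ℝ) hne'
    exact ⟨⟨fun p : Metric.closedBall (0 : Euc r) (max R R') × ClosureOf D => w (p.1, p.2),
      by fun_prop⟩, ⟨w, fun _ => rfl⟩, hw⟩
  set V := (volume : Measure D).real univ
  have hV : 0 ≤ V := measureReal_nonneg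
  have hi : Integrable fun x : D => ‖u' (toClosure x) - u (toClosure x)‖ :=
    integrable_comp_toClosure hD (g := fun x => ‖u' x - u x‖) (by fun_prop)
  -- The test function `(z, x) ↦ ‖z - u x‖` is approximated by exponentials of linear functionals.
  -- Its integral along the graph of `u` is zero, and the approximants have equal integrals along
  -- both graphs, so its integral along the graph of `u'` is zero as well.
  have hzero : ∫ x : D, ‖u' (toClosure x) - u (toClosure x)‖ = 0 := by
    refine eq_of_abs_sub_le_all fun ε hε => ?_
    obtain ⟨n, a, l, hl, hφ⟩ := exists_sum_exp_near S hS
      ⟨fun p : Metric.closedBall (0 : Euc r) (max R R') × ClosureOf D => ‖(p.1 : Euc r) - u p.2‖,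
        by fun_prop⟩ (ε := ε / (2 * (V + 1))) (by positivity)
    choose w hw using hl
    have key {f : ClosureOf D → Euc r} (hf : Continuous f) (hfR : ∀ x, ‖f x‖ ≤ max R R') :
        |(∫ x : D, ‖f (toClosure x) - u (toClosure x)‖) -
          ∑ i, a i * ∫ x : D, Real.exp (w i (f (toClosure x), x))| ≤ ε / 2 := by
      have hint (i : Fin n) : Integrable fun x : D => Real.exp (w i (f (toClosure x), x)) :=
        integrable_comp_toClosure hD (g := fun x => Real.exp (w i (f x, (x : Euc d))))
          (by fun_prop)
      have hsum : ∑ i, a i * ∫ x : D, Real.exp (w i (f (toClosure x), x)) =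
          ∫ x : D, ∑ i, a i * Real.exp (w i (f (toClosure x), x)) := by
        rw [integral_finsetSum _ fun i _ => (hint i).const_mul _]
        simp_rw [integral_const_mul]
      rw [hsum]
      refine (abs_integral_sub_le hD (ε := ε / (2 * (V + 1)))
        (integrable_comp_toClosure hD (g := fun x => ‖f x - u x‖) (by fun_prop))
        (integrable_finsetSum _ fun i _ => (hint i).const_mul _) (fun x => ?_)).trans ?_
      · have := hφ (⟨f (toClosure x), by simpa using hfR _⟩, toClosure x)
        simp only [hw] at this
        exact this
      · calc ε / (2 * (V + 1)) * V ≤ ε / (2 * (V + 1)) * (V + 1) := by gcongr; linarith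
          _ = ε / 2 := by field_simp
    have h1 := key hu fun x => (hR x (mem_univ _)).trans (le_max_left _ _)
    have h2 := key hu' fun x => (hR' x (mem_univ _)).trans (le_max_right _ _)
    simp_rw [hexp, sub_self, norm_zero, integral_zero] at h1
    rw [abs_le] at h1 h2 ⊢
    constructor <;> linarith
  have hae := (integral_eq_zero_iff_of_nonneg (fun _ => norm_nonneg _) hi).1 hzero
  have hc : Continuous fun x : D => ‖u' (toClosure x) - u (toClosure x)‖ := by
    have := continuous_toClosure (D := D)
    fun_prop
  have := congrFun ((hc.ae_eq_iff_eq volume continuous_const).1 hae) x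
  exact (sub_eq_zero.1 (norm_eq_zero.1 this)).symm

end Averages

/-! ### Approximation of continuous maps into a normed space by tensors -/

section Tensor

variable {X V : Type*} [TopologicalSpace X]
  [NormedAddCommGroup V] [NormedSpace ℝ V]

/-- The tensor `x ↦ α x • v`. -/
noncomputable def ContinuousMap.tensor (α : C(X, ℝ)) (v : V) : C(X, V) :=
  ⟨fun x => α x • v, by fun_prop⟩

lemma ContinuousMap.continuous_tensor_left (v : V) :
    Continuous fun α : C(X, ℝ) => α.tensor v :=
  ContinuousMap.continuous_postcomp ⟨fun t : ℝ => t • v, by fun_prop⟩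

lemma ContinuousMap.continuous_tensor_right (α : C(X, ℝ)) :
    Continuous fun v : V => α.tensor v := by
  refine ContinuousMap.continuous_of_continuous_uncurry _ ?_
  simp only [Function.uncurry_def, ContinuousMap.tensor, ContinuousMap.coe_mk]
  fun_prop

/-- A closed subspace of `C(X, V)` that contains all tensors is the whole space. -/
lemma eq_top_of_tensor_mem [CompactSpace X] [T2Space X] {M : Submodule ℝ C(X, V)}
    (hM : IsClosed (M : Set C(X, V))) (h : ∀ α v, ContinuousMap.tensor α v ∈ M) : M = ⊤ := by
  refine Submodule.eq_top_iff'.2 fun Φ => ?_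
  rw [← SetLike.mem_coe, ← hM.closure_eq, Metric.mem_closure_iff]
  intro ε hε
  obtain ⟨T, -, hT⟩ := isCompact_univ.elim_nhds_subcover
    (fun x : X => Φ ⁻¹' Metric.ball (Φ x) (ε / 2))
    fun x _ => Φ.continuous.continuousAt (Metric.ball_mem_nhds _ (by positivity))
  obtain ⟨χ, hχ⟩ := PartitionOfUnity.exists_isSubordinate isClosed_univ
    (fun i : T => Φ ⁻¹' Metric.ball (Φ i) (ε / 2))
    (fun i => Metric.isOpen_ball.preimage Φ.continuous) (by simpa only [iUnion_subtype] using hT)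
  refine ⟨∑ i : T, (χ i).tensor (Φ i), M.sum_mem fun i _ => h _ _, ?_⟩
  refine (ContinuousMap.dist_le (by positivity : 0 ≤ ε / 2)).2 (fun x => ?_) |>.trans_lt
    (by linarith)
  have hsum : ∑ i, χ i x = 1 := by
    rw [← finsum_eq_sum_of_fintype]
    exact χ.sum_eq_one (mem_univ x)
  have e : Φ x - (∑ i : T, (χ i).tensor (Φ i)) x = ∑ i : T, χ i x • (Φ x - Φ i) := by
    simp only [smul_sub, Finset.sum_sub_distrib, ← Finset.sum_smul, hsum, one_smul,
      ContinuousMap.sum_apply, ContinuousMap.tensor, ContinuousMap.coe_mk]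
  rw [dist_eq_norm, e]
  calc ‖∑ i : T, χ i x • (Φ x - Φ i)‖ ≤ ∑ i : T, χ i x * (ε / 2) := by
        refine norm_sum_le_of_le _ fun i _ => ?_
        rw [norm_smul, Real.norm_of_nonneg (χ.nonneg i x)]
        by_cases hx : χ i x = 0
        · simp [hx]
        · have hx' := hχ i (subset_tsupport _ hx)
          refine mul_le_mul_of_nonneg_left ?_ (χ.nonneg i x)
          rw [← dist_eq_norm]
          exact (Metric.mem_ball.1 hx').le
    _ = ε / 2 := by rw [← Finset.sum_mul, hsum, one_mul]

/-- Tensors of elements of total sets are total. -/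
lemma exists_sum_tensor_near [CompactSpace X] [T2Space X] {A : Set C(X, ℝ)} {B : Set V}
    (hA : (Submodule.span ℝ A).topologicalClosure = ⊤)
    (hB : (Submodule.span ℝ B).topologicalClosure = ⊤) (Φ : C(X, V)) {ε : ℝ} (hε : 0 < ε) :
    ∃ (n : ℕ) (c : Fin n → ℝ) (α : Fin n → C(X, ℝ)) (v : Fin n → V), (∀ i, α i ∈ A) ∧
      (∀ i, v i ∈ B) ∧ ∀ x, ‖Φ x - ∑ i, c i • α i x • v i‖ ≤ ε := by
  set M := (Submodule.span ℝ (image2 ContinuousMap.tensor A B)).topologicalClosure with hM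
  have hMc : IsClosed (M : Set C(X, V)) := Submodule.isClosed_topologicalClosure _
  -- Totality is used one factor at a time: for a fixed second factor, the admissible first factors
  -- form a closed subspace containing `A`. Then the roles are exchanged, with `α` arbitrary.
  have h1 (α : C(X, ℝ)) {v : V} (hv : v ∈ B) : ContinuousMap.tensor α v ∈ M := by
    let N : Submodule ℝ C(X, ℝ) :=
      Submodule.comap (σ₁₂ := RingHom.id ℝ)
        { toFun := fun α => α.tensor v
          map_add' := fun _ _ => by ext; simp [ContinuousMap.tensor, add_smul]
          map_smul' := fun _ _ => by ext; simp [ContinuousMap.tensor, mul_smul] } M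
    have hN : (Submodule.span ℝ A).topologicalClosure ≤ N :=
      Submodule.topologicalClosure_minimal _ (Submodule.span_le.2 fun α hα =>
        Submodule.le_topologicalClosure _ (Submodule.subset_span ⟨α, hα, v, hv, rfl⟩))
        (hMc.preimage (ContinuousMap.continuous_tensor_left v))
    rw [hA] at hN
    exact hN (Submodule.mem_top : α ∈ ⊤)
  have h2 (α : C(X, ℝ)) (v : V) : ContinuousMap.tensor α v ∈ M := by
    let N : Submodule ℝ V :=
      Submodule.comap (σ₁₂ := RingHom.id ℝ)
        { toFun := fun v => α.tensor v
          map_add' := fun _ _ => by ext; simp [ContinuousMap.tensor]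
          map_smul' := fun c v => by ext x; exact smul_comm (α x) c v } M
    have hN : (Submodule.span ℝ B).topologicalClosure ≤ N :=
      Submodule.topologicalClosure_minimal _ (Submodule.span_le.2 fun v hv => h1 α hv)
        (hMc.preimage (ContinuousMap.continuous_tensor_right α))
    rw [hB] at hN
    exact hN (Submodule.mem_top : v ∈ ⊤)
  have hΦ : Φ ∈ M := by rw [eq_top_of_tensor_mem hMc h2]; exact Submodule.mem_top
  obtain ⟨g, hg, hdist⟩ := Metric.mem_closure_iff.1 hΦ ε hε
  replace hg : g ∈ Submodule.span ℝ (image2 ContinuousMap.tensor A B) := hg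
  rw [Submodule.mem_span_set'] at hg
  obtain ⟨n, c, t, rfl⟩ := hg
  choose α hα v hv ht using fun i => (t i).2
  refine ⟨n, c, α, v, hα, hv, fun x => ?_⟩
  have := (ContinuousMap.dist_apply_le_dist x).trans hdist.le
  rw [dist_eq_norm] at this
  simpa [← ht, ContinuousMap.tensor] using this

end Tensor

/-! ### Ridge functions in `C^s(D̄; F)` -/

section RidgeBound

variable {d : ℕ} {F : Type*} [NormedAddCommGroup F] [NormedSpace ℝ F]

/-- Chain rule through the linear functional `⟪q, ·⟫`, of norm `‖q‖`. It converts one-dimensional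
derivative bounds into `C^s` bounds. -/
lemma norm_iteratedFDeriv_ridge_le {g : ℝ → ℝ} (hg : ContDiff ℝ ∞ g) (q : Euc d) (c : ℝ) (a : F)
    (j : ℕ) (x : Euc d) : ‖iteratedFDeriv ℝ j (fun y => g (c + ⟪q, y⟫) • a) x‖ ≤
      |iteratedDeriv j g (c + ⟪q, x⟫)| * (‖q‖ ^ j * ‖a‖) := by
  have hgc : ContDiff ℝ ∞ fun t => g (c + t) := hg.comp (contDiff_const.add contDiff_id)
  have hG : ContDiff ℝ ∞ fun t => g (c + t) • a := hgc.smul contDiff_const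
  have e : (fun y => g (c + ⟪q, y⟫) • a) = (fun t => g (c + t) • a) ∘ innerSL ℝ q := rfl
  rw [e, (innerSL ℝ q).iteratedFDeriv_comp_right hG x (i := j) (by exact_mod_cast le_top)]
  refine (ContinuousMultilinearMap.norm_compContinuousLinearMap_le _ _).trans ?_
  rw [norm_iteratedFDeriv_eq_norm_iteratedDeriv, iteratedDeriv_smul_const
    (hgc.contDiffAt.of_le (by exact_mod_cast le_top)), norm_smul, iteratedDeriv_comp_const_add,
    Finset.prod_const, Finset.card_univ, Fintype.card_fin, innerSL_apply_norm, Real.norm_eq_abs]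
  apply le_of_eq
  simp only [innerSL_apply_apply]
  ring

end RidgeBound

/-! ### Networks that compute ridge functions of averages -/

section Network

variable {d : ℕ} {D : TopologicalSpace.Opens (Euc d)}

/-- A linear map into Euclidean space with prescribed components. -/
noncomputable def toEuc {E : Type*} [NormedAddCommGroup E] [NormedSpace ℝ E] {n : ℕ}
    (f : Fin n → E →L[ℝ] ℝ) : E →L[ℝ] Euc n :=
  (EuclideanSpace.equiv (Fin n) ℝ).symm.toContinuousLinearMap ∘L ContinuousLinearMap.pi f

lemma toEuc_apply {E : Type*} [NormedAddCommGroup E] [NormedSpace ℝ E] {n : ℕ}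
    (f : Fin n → E →L[ℝ] ℝ) (x : E) (i : Fin n) : toEuc f x i = f i x := rfl

/-- Zero queries and keys make every exponential equal to `1`, so the density is constant. -/
lemma crossAttention_uniform {Y : Type*} {m n k : ℕ} (V : Euc n →L[ℝ] Euc k)
    (v : Y → Euc m) (u : D → Euc n) (x : Y) :
    (AttentionParams.mk 0 0 0 V).crossAttention v u x = ⨍ y : D, V (u y) := by
  simp only [AttentionParams.crossAttention, AttentionParams.density,
    zero_apply, inner_zero_left, Real.exp_zero, integral_const, smul_eq_mul,
    mul_one, one_div, average_eq, integral_smul]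

/-- The encoder layer that computes the identity. -/
def EncoderLayer.identity (c : ℕ) : EncoderLayer c where
  att := ⟨0, 0, 0, 0⟩
  W₁ := ContinuousLinearMap.id ℝ _
  W₂ := ContinuousLinearMap.id ℝ _
  width := 0
  W₃ := 0
  W₄ := 0
  b₁ := 0
  b₂ := 0

lemma EncoderLayer.identity_eval (σ : ℝ → ℝ) {c : ℕ} (u : D → Euc c) :
    (EncoderLayer.identity c).eval σ u = u := by
  funext x
  simp [EncoderLayer.eval, EncoderLayer.identity, crossAttention_uniform]
  rfl

/-- The decoder that computes the average of the encoded input. -/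
def Decoder.averaging (l c : ℕ) : Decoder l c where
  Sin := 0
  att₁ := ⟨0, 0, 0, 0⟩
  att₂ := ⟨0, 0, 0, ContinuousLinearMap.id ℝ _⟩
  W₁ := 0
  W₂ := 0
  W₃ := ContinuousLinearMap.id ℝ _
  width := 0
  W₄ := 0
  W₅ := 0
  b₁ := 0
  b₂ := 0

lemma Decoder.averaging_eval (σ : ℝ → ℝ) {l c : ℕ} (v : D → Euc l) (u : D → Euc c) (x : D) :
    (Decoder.averaging l c).eval σ v u x = ⨍ y : D, u y := by
  simp [Decoder.eval, Decoder.averaging, crossAttention_uniform]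
  rfl

lemma foldl_identity (σ : ℝ → ℝ) {c : ℕ} (L : ℕ) (u : D → Euc c) :
    (List.ofFn fun _ : Fin L => EncoderLayer.identity c).foldl
      (fun w layer => layer.eval σ w) u = u := by
  rw [List.ofFn_const]
  induction L with
  | zero => rfl
  | succ L ih => rw [List.replicate_succ, List.foldl_cons, EncoderLayer.identity_eval, ih]

/-- Combinations of ridge functions of `x` and of averages of ridge functions of `(u(y), y)` are
computed by cross-attention based transformer neural operators. -/
lemma exists_crossTransformer_eval_eq (hD : IsBoundedLipschitzDomain D) {l r r' L : ℕ}
    {σ : ℝ → ℝ} (hσ : Continuous σ) (v : D → Euc l) {ι κ : Type} [Fintype ι] [Fintype κ]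
    (w : ι → (Euc r × Euc d) →L[ℝ] ℝ) (β : ι → ℝ) (C : κ → ι → ℝ) (q : κ → Euc d) (b : κ → ℝ)
    (a : κ → Euc r') :
    ∃ θ : CrossTransformer L d l r r', ∀ u : ClosureOf D → Euc r, Continuous u → ∀ x : D,
      θ.eval σ v (fun y : D => u (toClosure y)) x =
        ∑ k, σ (∑ i, C k i * (⨍ y : D, σ (w i (u (toClosure y), y) + β i)) +
          ⟪q k, (x : Euc d)⟫ + b k) • a k := by
  let e := Fintype.equivFin ι
  let f := Fintype.equivFin κ
  let Tin : PointwiseNet r d (Fintype.card ι) :=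
    { width := Fintype.card ι
      A₁ := toEuc fun i => w (e.symm i)
      b := WithLp.toLp 2 fun i => β (e.symm i)
      A₂ := ContinuousLinearMap.id ℝ _
      b' := 0 }
  let Tout : PointwiseNet (Fintype.card ι) d r' :=
    { width := Fintype.card κ
      A₁ := toEuc fun k =>
        (∑ i, C (f.symm k) (e.symm i) •
          (EuclideanSpace.proj i : Euc (Fintype.card ι) →L[ℝ] ℝ)).comp
          (ContinuousLinearMap.fst ℝ _ _) +
        (innerSL ℝ (q (f.symm k))).comp (ContinuousLinearMap.snd ℝ _ _)
      b := WithLp.toLp 2 fun k => b (f.symm k)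
      A₂ := ∑ k, (EuclideanSpace.proj k : Euc (Fintype.card κ) →L[ℝ] ℝ).smulRight (a (f.symm k))
      b' := 0 }
  refine ⟨⟨Fintype.card ι, Tin, fun _ => EncoderLayer.identity _, Decoder.averaging _ _, Tout⟩,
    fun u hu x => ?_⟩
  have hin (y : D) (i : Fin (Fintype.card ι)) : Tin.eval σ (fun y : D => u (toClosure y)) y i =
      σ (w (e.symm i) (u (toClosure y), y) + β (e.symm i)) := by
    simp [PointwiseNet.eval, Tin, applyAct, toEuc_apply]
  have havg (i : Fin (Fintype.card ι)) :
      (⨍ y : D, Tin.eval σ (fun y : D => u (toClosure y)) y) i =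
        ⨍ y : D, σ (w (e.symm i) (u (toClosure y), y) + β (e.symm i)) := by
    rw [average_eq, average_eq, PiLp.smul_apply, eval_integral_piLp]
    · simp only [hin]
    · intro i
      simp only [hin]
      exact integrable_comp_toClosure hD
        (g := fun y => σ (w (e.symm i) (u y, (y : Euc d)) + β (e.symm i))) (by fun_prop)
  rw [CrossTransformer.eval]
  simp only [foldl_identity]
  rw [PointwiseNet.eval, Decoder.averaging_eval]
  simp only [Tout, add_zero, sum_apply, ContinuousLinearMap.smulRight_apply,
    PiLp.proj_apply, applyAct, PiLp.add_apply, toEuc_apply,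
    add_apply, ContinuousLinearMap.comp_apply, ContinuousLinearMap.coe_fst',
    ContinuousLinearMap.coe_snd', innerSL_apply_apply, smul_apply,
    smul_eq_mul, havg]
  rw [← f.symm.sum_comp]
  refine Finset.sum_congr rfl fun k _ => ?_
  rw [← e.symm.sum_comp]

end Network

/-! ### Universal approximation -/

section Universal

variable {d r r' : ℕ} {D : TopologicalSpace.Opens (Euc d)} {s s' : ℕ}

/-- The integral is Lipschitz in `u`, because `σ` is Lipschitz and the `C^s` norm dominates the
supremum norm. -/
lemma continuous_average_ridge (hD : IsBoundedLipschitzDomain D) {σ : ℝ → ℝ} {M : NNReal}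
    (hσ : LipschitzWith M σ) (w : (Euc r × Euc d) →L[ℝ] ℝ) (β : ℝ) :
    Continuous fun u : CkBar D s (Euc r) => ⨍ y : D, σ (w (u (toClosure y), y) + β) := by
  have hint (u : CkBar D s (Euc r)) :
      Integrable fun y : D => σ (w (u (toClosure y), y) + β) := by
    have := hσ.continuous
    have := u.toBCF.continuous
    exact integrable_comp_toClosure hD (g := fun y => σ (w (u y, (y : Euc d)) + β)) (by fun_prop)
  simp only [average_eq]
  suffices hc : Continuous fun u : CkBar D s (Euc r) =>
      ∫ y : D, σ (w (u (toClosure y), y) + β) by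
    simp only [smul_eq_mul]
    exact continuous_const.mul hc
  refine (LipschitzWith.of_dist_le_mul (K := M * ‖w‖₊ * ((volume : Measure D).real univ).toNNReal)
    fun u u' => ?_).continuous
  rw [Real.dist_eq]
  refine (abs_integral_sub_le hD (hint u) (hint u') (ε := M * (‖w‖ * dist u u'))
    fun y => ?_).trans (le_of_eq ?_)
  · rw [← Real.dist_eq]
    refine (hσ.dist_le_mul _ _).trans ?_
    gcongr
    rw [dist_add_right, dist_eq_norm, ← map_sub, Prod.mk_sub_mk, sub_self]
    refine (w.le_opNorm _).trans ?_
    gcongr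
    rw [Prod.norm_mk, norm_zero, max_eq_left (norm_nonneg _), dist_eq_norm]
    exact (u - u').norm_apply_le (toClosure y)
  · push_cast
    rw [Real.coe_toNNReal _ measureReal_nonneg]
    ring

/-- The average of a ridge function of `(u(x), x)`, as a continuous function of `u ∈ K`. -/
noncomputable def averageRidge (hD : IsBoundedLipschitzDomain D) {σ : ℝ → ℝ} {M : NNReal}
    (hσ : LipschitzWith M σ) (K : Set (CkBar D s (Euc r)))
    (p : ((Euc r × Euc d) →L[ℝ] ℝ) × ℝ) : C(K, ℝ) :=
  ⟨fun u => ⨍ y : D, σ (p.1 (u.1 (toClosure y), y) + p.2),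
    (continuous_average_ridge hD hσ p.1 p.2).comp continuous_subtype_val⟩

lemma averageRidge_separates (hD : IsBoundedLipschitzDomain D) {σ : ℝ → ℝ}
    (hσ : ContDiff ℝ ∞ σ) (hσp : ¬ ∃ p : ℝ[X], ∀ x : ℝ, σ x = p.eval x) {M : NNReal}
    (hσL : LipschitzWith M σ) {K : Set (CkBar D s (Euc r))} {u u' : K} (hne : u ≠ u') :
    ∃ p, averageRidge hD hσL K p u ≠ averageRidge hD hσL K p u' := by
  by_contra! h
  have := isFiniteMeasure_opens hD.bounded
  have := isOpenPosMeasure_opens (D := D)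
  have : Nonempty D := hD.connected.nonempty.to_subtype
  have hV : (volume : Measure D).real univ ≠ 0 := by
    rw [measureReal_ne_zero_iff]
    exact isOpen_univ.measure_ne_zero _ univ_nonempty
  refine hne (Subtype.ext (CkBar.ext_toClosure fun x => ?_))
  refine eq_of_integral_ridge_eq hD hσ hσp u.1.toBCF.continuous u'.1.toBCF.continuous
    (fun w b => ?_) x
  have hwb := h (w, b)
  simp only [averageRidge, ContinuousMap.coe_mk, average_eq, smul_eq_mul] at hwb
  exact mul_left_cancel₀ (inv_ne_zero hV) hwb

/-- Take the union of the supports. A single network has one list of channels, so all the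
combinations `l i` must use the same finite family of averages. -/
lemma exists_common_coefficients {P V : Type*} [AddCommGroup V] [Module ℝ V] (f : P → V) {n : ℕ}
    (l : Fin n → V) (hl : ∀ i, l i ∈ Submodule.span ℝ (range f)) :
    ∃ (T : Finset P) (C : Fin n → T → ℝ), ∀ i, l i = ∑ p, C i p • f p := by
  classical
  choose c hc using fun i => Finsupp.mem_span_range_iff_exists_finsupp.1 (hl i)
  refine ⟨Finset.univ.biUnion fun i => (c i).support, fun i p => c i p, fun i => ?_⟩
  rw [← hc i, Finset.sum_coe_sort _ (fun p => c i p • f p)]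
  exact Finsupp.sum_of_support_subset _
    (Finset.subset_biUnion_of_mem (fun i => (c i).support) (Finset.mem_univ i)) _ (by simp)

/-- Maps of the form `u ↦ ∑ exp (l(u) + ⟪q, ·⟫) a`, with `l` in the span of the averages of ridge
functions, approximate all continuous maps on a compact set. -/
lemma exists_sum_exp_average_near (hD : IsBoundedLipschitzDomain D) {σ : ℝ → ℝ}
    (hσ : ContDiff ℝ ∞ σ) (hσp : ¬ ∃ p : ℝ[X], ∀ x : ℝ, σ x = p.eval x) {M : NNReal}
    (hσL : LipschitzWith M σ) {K : Set (CkBar D s (Euc r))} (hK : IsCompact K)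
    {Ψ : CkBar D s (Euc r) → CkBar D s' (Euc r')} (hΨ : Continuous Ψ) {ε : ℝ} (hε : 0 < ε) :
    ∃ (n : ℕ) (l : Fin n → C(K, ℝ)) (q : Fin n → Euc d) (a : Fin n → Euc r'),
      (∀ i, l i ∈ Submodule.span ℝ (range (averageRidge hD hσL K))) ∧
      ∀ u : K, ∃ T : CkBar D s' (Euc r'), ‖Ψ u - T‖ ≤ ε ∧ ∀ x : D,
        T (toClosure x) = ∑ i, Real.exp (l i u + ⟪q i, (x : Euc d)⟫) • a i := by
  have := isCompact_iff_compactSpace.1 hK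
  have := hD.compactSpace_closureOf
  let S := Submodule.span ℝ (range (averageRidge hD hσL K))
  let A : Set C(K, ℝ) := {α | ∃ l ∈ S, l.rexp = α}
  let B : Set (CkBar D s' (Euc r')) := {e | ∃ q a, ∀ x : D,
    e (toClosure x) = Real.exp ⟪q, (x : Euc d)⟫ • a}
  have hA : (Submodule.span ℝ A).topologicalClosure = ⊤ := by
    refine Submodule.eq_top_iff'.2 fun α => Metric.mem_closure_iff.2 fun δ hδ => ?_
    obtain ⟨n, a, l, hl, h⟩ := exists_sum_exp_near S (fun u u' hne => by
      obtain ⟨p, hp⟩ := averageRidge_separates hD hσ hσp hσL hne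
      exact ⟨_, Submodule.subset_span ⟨p, rfl⟩, hp⟩) α (half_pos hδ)
    refine ⟨∑ i, a i • (l i).rexp, Submodule.sum_mem _ fun i _ =>
      Submodule.smul_mem _ _ (Submodule.subset_span ⟨l i, hl i, rfl⟩), ?_⟩
    refine ((ContinuousMap.dist_le (half_pos hδ).le).2 fun u => ?_).trans_lt (half_lt_self hδ)
    rw [Real.dist_eq]
    simpa [ContinuousMap.rexp] using h u
  have hB : (Submodule.span ℝ B).topologicalClosure = ⊤ := by
    refine Submodule.eq_top_iff'.2 fun f => Metric.mem_closure_iff.2 fun δ hδ => ?_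
    obtain ⟨n, q, a, h⟩ := hD.exists_sum_exp_near f (half_pos hδ)
    choose e he using fun i => CkBar.exists_restrict (D := D) (s := s')
      (G := fun y => Real.exp ⟪q i, y⟫ • a i)
      ((contDiff_const.inner ℝ contDiff_id).exp.smul contDiff_const)
    refine ⟨∑ i, e i, Submodule.sum_mem _ fun i _ =>
      Submodule.subset_span ⟨q i, a i, fun x => he i (toClosure x)⟩, ?_⟩
    rw [dist_eq_norm]
    refine (h _ fun x => ?_).trans_lt (half_lt_self hδ)
    rw [CkBar.sum_apply]
    exact Finset.sum_congr rfl fun i _ => he i (toClosure x)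
  obtain ⟨n, c, α, e, hα, he, h⟩ := exists_sum_tensor_near hA hB
    ⟨fun u : K => Ψ u, hΨ.comp continuous_subtype_val⟩ hε
  choose l hl hlα using hα
  choose q a hqa using he
  refine ⟨n, l, q, fun i => c i • a i, hl, fun u => ⟨_, h u, fun x => ?_⟩⟩
  rw [CkBar.sum_apply]
  refine Finset.sum_congr rfl fun i _ => ?_
  rw [CkBar.smul_apply, CkBar.smul_apply, hqa, ← hlα i, Real.exp_add, smul_smul, smul_smul,
    smul_smul]
  congr 1
  simp only [ContinuousMap.rexp, ContinuousMap.coe_mk]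
  ring

end Universal

/-! ### From exponentials to the activation function, and the main theorem -/

lemma norm_sub_sum_ridge_le {d : ℕ} {D : TopologicalSpace.Opens (Euc d)} {s : ℕ} {F : Type*}
    [NormedAddCommGroup F] [NormedSpace ℝ F] {g φ : ℝ → ℝ} (hg : ContDiff ℝ ∞ g)
    (hφ : ContDiff ℝ ∞ φ) {n : ℕ} (c : Fin n → ℝ) (q : Fin n → Euc d) (a : Fin n → F) {η : ℝ}
    (hη : 0 ≤ η) (h : ∀ j ≤ s, ∀ x ∈ D, ∀ i,
      |iteratedDeriv j (fun t => g t - φ t) (c i + ⟪q i, x⟫)| ≤ η) {f f' : CkBar D s F}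
    (hf : ∀ x : D, f (toClosure x) = ∑ i, g (c i + ⟪q i, (x : Euc d)⟫) • a i)
    (hf' : ∀ x : D, f' (toClosure x) = ∑ i, φ (c i + ⟪q i, (x : Euc d)⟫) • a i) :
    ‖f - f'‖ ≤ (s + 1) * (η * ∑ i, (1 + ‖q i‖) ^ s * ‖a i‖) := by
  refine CkBar.norm_le_of_iteratedFDeriv _ (by positivity) fun j hj x hx => ?_
  have e : extZero (f - f') =ᶠ[nhds x]
      fun y => ∑ i, (g (c i + ⟪q i, y⟫) - φ (c i + ⟪q i, y⟫)) • a i :=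
    extZero_eventuallyEq (fun y => by
      rw [CkBar.coe_sub, hf, hf', ← Finset.sum_sub_distrib]
      simp only [sub_smul]) hx
  have hgφ : ContDiff ℝ ∞ fun t => g t - φ t := hg.sub hφ
  have hi (i : Fin n) : ContDiffAt ℝ j
      (fun y => (g (c i + ⟪q i, y⟫) - φ (c i + ⟪q i, y⟫)) • a i) x :=
    (((hgφ.comp (contDiff_const.add (contDiff_const.inner ℝ contDiff_id))).smul
      contDiff_const).contDiffAt.of_le (by exact_mod_cast le_top))
  rw [(e.iteratedFDeriv ℝ j).eq_of_nhds, iteratedFDeriv_fun_sum_apply fun i _ => hi i,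
    Finset.mul_sum]
  refine norm_sum_le_of_le _ fun i _ => ?_
  refine (norm_iteratedFDeriv_ridge_le hgφ (q i) (c i) (a i) j x).trans ?_
  gcongr
  · exact h j hj x hx i
  -- The base `1 + ‖q i‖` is at least `1`, so one power bounds all orders `j ≤ s`.
  · calc ‖q i‖ ^ j ≤ (1 + ‖q i‖) ^ j := by gcongr; linarith
      _ ≤ (1 + ‖q i‖) ^ s := pow_le_pow_right₀ (by linarith [norm_nonneg (q i)]) hj

theorem mainTheorem6 {d r r' l L : ℕ} (hL : 1 ≤ L) (s s' : ℕ)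
    (D : TopologicalSpace.Opens (Euc d)) (hD : IsBoundedLipschitzDomain D)
    (σ : ℝ → ℝ) (hσ : ContDiff ℝ ∞ σ) (hσLip : ∃ M : NNReal, LipschitzWith M σ)
    (hσpoly : ¬ ∃ p : ℝ[X], ∀ x : ℝ, σ x = p.eval x)
    (v : D → Euc l) (hv : Measurable v) (hvb : ∃ B : ℝ, ∀ x, ‖v x‖ ≤ B)
    (Ψ : CkBar D s (Euc r) → CkBar D s' (Euc r')) (hΨ : Continuous Ψ)
    (K : Set (CkBar D s (Euc r))) (hK : IsCompact K) (ε : ℝ) (hε : 0 < ε) :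
    ∃ θ : CrossTransformer L d l r r', ∀ u ∈ K, ∃ w : CkBar D s' (Euc r'),
      (∀ x : D, w (toClosure x) = θ.eval σ v (fun y : D => u (toClosure y)) x) ∧
        ‖Ψ u - w‖ ≤ ε := by
  obtain ⟨M, hσL⟩ := hσLip
  have := isCompact_iff_compactSpace.1 hK
  have := hD.compactSpace_closureOf
  obtain ⟨n, ls, q, a, hls, hT⟩ :=
    exists_sum_exp_average_near hD hσ hσpoly hσL hK hΨ (half_pos hε)
  obtain ⟨P, C, hC⟩ := exists_common_coefficients _ ls hls
  obtain ⟨R₀, hR₀⟩ := hD.bounded.subset_closedBall (0 : Euc d)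
  -- A bound, uniform in `i`, `u ∈ K` and `x ∈ D`, for the arguments of the exponentials: `exp` has
  -- to be approximated only on `[-R, R]`.
  set R : ℝ := ∑ i, (‖ls i‖ + ‖q i‖ * |R₀|) with hR
  have hbound (i : Fin n) (u : K) {x : Euc d} (hx : x ∈ D) : |ls i u + ⟪q i, x⟫| ≤ R := by
    have h1 : |ls i u| ≤ ‖ls i‖ := (ls i).norm_coe_le_norm u
    have h2 : ‖x‖ ≤ |R₀| := (mem_closedBall_zero_iff.1 (hR₀ hx)).trans (le_abs_self _)
    have h3 : |⟪q i, x⟫| ≤ ‖q i‖ * |R₀| :=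
      (abs_real_inner_le_norm _ _).trans (mul_le_mul_of_nonneg_left h2 (norm_nonneg _))
    refine ((abs_add_le _ _).trans (add_le_add h1 h3)).trans ?_
    exact Finset.single_le_sum (f := fun i => ‖ls i‖ + ‖q i‖ * |R₀|)
      (fun i _ => by positivity) (Finset.mem_univ i)
  set Q : ℝ := ∑ i, (1 + ‖q i‖) ^ s' * ‖a i‖ with hQ
  have hQ0 : 0 ≤ Q := by positivity
  set η : ℝ := ε / 2 / ((s' + 1) * (Q + 1)) with hη
  have hη0 : 0 < η := by positivity
  obtain ⟨m, c, lam, b, hφ⟩ := exists_sum_ridge_near_exp hσ hσpoly R s' hη0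
  set φ : ℝ → ℝ := fun t => ∑ k, c k * σ (lam k * t + b k) with hφdef
  have hφs : ContDiff ℝ ∞ φ := ContDiff.sum fun k _ => contDiff_const.mul
    (hσ.comp ((contDiff_const.mul contDiff_id).add contDiff_const))
  -- Each exponential term `i` becomes `m` neurons `σ (lam k * (l i u + ⟪q i, x⟫) + b k)`, hence the
  -- index set `Fin n × Fin m`. The factor `lam k` goes into the coefficients of the averages and
  -- into `q i`, the outer factor `c k` into `a i`.
  obtain ⟨θ, hθ⟩ := exists_crossTransformer_eval_eq (L := L) hD hσ.continuous v
    (ι := P) (κ := Fin n × Fin m) (fun p => p.1.1) (fun p => p.1.2)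
    (fun k p => lam k.2 * C k.1 p) (fun k => lam k.2 • q k.1) (fun k => b k.2)
    (fun k => c k.2 • a k.1)
  refine ⟨θ, fun u hu => ?_⟩
  obtain ⟨w, hw⟩ := CkBar.exists_restrict (D := D) (s := s')
    (G := fun y => ∑ i, φ (ls i ⟨u, hu⟩ + ⟪q i, y⟫) • a i)
    (ContDiff.sum fun i _ => ((hφs.of_le (by exact_mod_cast le_top)).comp
      (contDiff_const.add (contDiff_const.inner ℝ contDiff_id))).smul contDiff_const)
  refine ⟨w, fun x => ?_, ?_⟩
  · rw [hw, hθ _ u.toBCF.continuous, Fintype.sum_prod_type]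
    refine Finset.sum_congr rfl fun i _ => ?_
    simp only [hφdef, Finset.sum_smul]
    refine Finset.sum_congr rfl fun k _ => ?_
    have hl : ls i ⟨u, hu⟩ = ∑ p : P, C i p *
        ⨍ y : D, σ (p.1.1 (u (toClosure y), y) + p.1.2) := by
      conv_lhs => rw [hC i]
      rw [ContinuousMap.sum_apply]
      rfl
    rw [hl, mul_add, Finset.mul_sum, inner_smul_left, smul_smul, mul_comm (c k)]
    simp only [mul_assoc]
    rfl
  · obtain ⟨T, hTΨ, hT⟩ := hT ⟨u, hu⟩
    have h1 := norm_sub_sum_ridge_le Real.contDiff_exp hφs (fun i => ls i ⟨u, hu⟩) q a hη0.le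
      (fun j hj x hx i => hφ j hj _ (hbound i ⟨u, hu⟩ hx)) hT fun x => hw (toClosure x)
    have h2 : (s' + 1) * (η * Q) ≤ ε / 2 := by
      calc (s' + 1) * (η * Q) ≤ (s' + 1) * (η * (Q + 1)) := by gcongr; linarith
        _ = ε / 2 := by rw [hη]; field_simp
    calc ‖Ψ u - w‖ = ‖(Ψ u - T) + (T - w)‖ := by rw [sub_add_sub_cancel]
      _ ≤ ε / 2 + ε / 2 := norm_add_le_of_le hTΨ (h1.trans h2)
      _ = ε := add_halves ε
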